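/- Conventions. All algebras are finite-dimensional over a field $\mathbb K$. An evolution algebra is an algebra with a natural basis, i.e. a basis $B=\{e_1,\dots,e_n\}$ with $e_ie_j=0$ for $i\ne j$; if $e_i^2=\sum_k a_{ik}e_k$, its structure matrix is $M_B=(a_{ik})$. Put $\mathcal E^1=\mathcal E$, $\mathcal E^{k+1}=\sum_{i=1}^k\mathcal E^i\mathcal E^{k+1-i}$ and $\mathcal E^{(1)}=\mathcal E$, $\mathcal E^{(k+1)}=\mathcal E^{(k)}\mathcal E^{(k)}$. $\mathcal E$ is nilpotent (solvable) if $\mathcal E^n=0$ ($\mathcal E^{(n)}=0$) for some $n\ge 1$, and the least such $n$ is its index of nilpotency (solvability). This index is called maximum if it is the largest one among all nilpotent (solvable) evolution algebras over $\mathbb K$ of the same dimension. For subalgebras, $\langle U,V\rangle$ is the subalgebra generated by $U\cup V$. $\mathcal E$ is distributive if $\langle U,V\cap W\rangle=\langle U,V\rangle\cap\langle U,W\rangle$ for all subalgebras $U,V,W$; modular if $\langle U,V\cap W\rangle=\langle U,V\rangle\cap W$ for all subalgebras with $U\subseteq W$; upper semimodular if, for all subalgebras $U,V$ with $U\cap V$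 maximal in $V$, $U$ is maximal in $\langle U,V\rangle$. For $1\le k\le n$ and $\lambda_1,\dots,\lambda_n\in\mathbb K$, not all zero, with $\lambda_1+\dots+\lambda_k=0$, let $\mathcal E_k(\lambda_1,\dots,\lambda_n)$ be the evolution algebra with natural basis $e_1,\dots,e_n$ and $e_i^2=\lambda_i(e_1+\dots+e_k)$ for all $i$. Let $r\ge 1$ and let $\mathcal E_1,\dots,\mathcal E_r$ be algebras of this kind with these natural bases $B_1,\dots,B_r$. An evolution algebra $\mathcal E$ belongs to $\mathcal F(\mathcal E_1,\dots,\mathcal E_r)$ if it has a natural basis $B$ containing the disjoint union of $B_1,\dots,B_r$, of $m$ elements, with $$M_B(\mathcal E)=\begin{pmatrix}A&0\\ C&L\end{pmatrix},$$ where $A$ is $m\times m$ block diagonal with blocks $M_{B_i}(\mathcal E_i)$, $L$ is strictly lower triangular and $C$ is arbitrary; then $\mathcal E_i$ is identified with the span of $B_i$ in $\mathcal E$, and $\mathcal E_i^2$ is an ideal of $\mathcal E$. Theorem. Let $\mathbb K$ be a quadratically closed field (every element is a square) of characteristic different from $2$, let $r\ge1$, let $\mathcal E_1,\dots,\mathcal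 E_r$ be solvable non-nilpotent algebras of the form $\mathcal E_k(\lambda_1,\dots,\lambda_n)$ (with $k$, $n$ and the $\lambda_i$ depending on the algebra), and let $\mathcal E$ be a solvable non-nilpotent evolution algebra in $\mathcal F(\mathcal E_1,\dots,\mathcal E_r)$. Then the following are equivalent: (i) $\mathcal E$ is distributive; (ii) $\mathcal E$ is modular and, consequently, upper semimodular; (iii) $r=1$, $\mathcal E_1\cong\mathcal E_2(1,-1)$, and the quotient $\mathcal E/\mathcal E_1^2$ is a nilpotent evolution algebra with maximum index of nilpotency; (iv) $\mathcal E$ has maximum index of solvability. In this case, with $n=\dim\mathcal E$, there is a natural basis $B$ of $\mathcal E$ such that $$M_B(\mathcal E)=\begin{pmatrix}A_{2\times2}&0_{2\times(n-2)}\\ C_{(n-2)\times2}&L_{(n-2)\times(n-2)}\end{pmatrix},\qquad A=\begin{pmatrix}1&1\\-1&-1\end{pmatrix},$$ where $L$ is strictly lower triangular with no zeros in its first lower diagonal and $M_B(\mathcal E)$ has rank $n-1$. -/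

import Mathlib

universe u v

namespace EvoAlg

/-! ### Algebras given by a structure matrix, quotients, ideals -/

/-- The algebra with basis `(e i)` and product `e i * e j = 0` for `i ≠ j`,
`e i * e i = ∑ k, M i k • e k`; its elements are the coordinate vectors. -/
def EvAlg {K : Type u} {ι : Type v} (_M : Matrix ι ι K) : Type (max u v) := ι → K

section EvAlg

variable {K : Type u} [Field K] {ι : Type v} (M : Matrix ι ι K)

instance : AddCommGroup (EvAlg M) := inferInstanceAs (AddCommGroup (ι → K))

instance : Module K (EvAlg M) := inferInstanceAs (Module K (ι → K))

theorem EvAlg.add_apply (x y : EvAlg M) (k : ι) : (x + y) k = x k + y k := rfl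

theorem EvAlg.zero_apply (k : ι) : (0 : EvAlg M) k = 0 := rfl

theorem EvAlg.smul_apply (c : K) (x : EvAlg M) (k : ι) : (c • x) k = c * x k := rfl

variable [Fintype ι]

instance : Mul (EvAlg M) := ⟨fun x y => (fun k => ∑ i, x i * y i * M i k : ι → K)⟩

theorem EvAlg.mul_apply (x y : EvAlg M) (k : ι) : (x * y) k = ∑ i, x i * y i * M i k := rfl

instance : NonUnitalNonAssocRing (EvAlg M) :=
  { (inferInstance : AddCommGroup (EvAlg M)), (inferInstance : Mul (EvAlg M)) with
    left_distrib := fun x y z => by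
      funext k
      simp only [EvAlg.mul_apply, EvAlg.add_apply, ← Finset.sum_add_distrib]
      exact Finset.sum_congr rfl fun i _ => by ring
    right_distrib := fun x y z => by
      funext k
      simp only [EvAlg.mul_apply, EvAlg.add_apply, ← Finset.sum_add_distrib]
      exact Finset.sum_congr rfl fun i _ => by ring
    zero_mul := fun x => by
      funext k
      simp [EvAlg.mul_apply, EvAlg.zero_apply]
    mul_zero := fun x => by
      funext k
      simp [EvAlg.mul_apply, EvAlg.zero_apply] }

instance : IsScalarTower K (EvAlg M) (EvAlg M) :=
  ⟨fun c x y => by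
    funext k
    simp only [smul_eq_mul, EvAlg.mul_apply, EvAlg.smul_apply, Finset.mul_sum]
    exact Finset.sum_congr rfl fun i _ => by ring⟩

instance : SMulCommClass K (EvAlg M) (EvAlg M) :=
  ⟨fun c x y => by
    funext k
    simp only [smul_eq_mul, EvAlg.mul_apply, EvAlg.smul_apply, Finset.mul_sum]
    exact Finset.sum_congr rfl fun i _ => by ring⟩

end EvAlg

/-- A subspace `J` is a (two-sided) ideal. -/
def IsIdeal {K : Type u} {A : Type v} [Field K] [NonUnitalNonAssocRing A] [Module K A]
    (J : Submodule K A) : Prop :=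
  ∀ a : A, ∀ x ∈ J, a * x ∈ J ∧ x * a ∈ J

/-- The quotient of an algebra by an ideal, with the induced product. -/
def QuotAlg {K : Type u} {A : Type v} [Field K] [NonUnitalNonAssocRing A] [Module K A]
    (J : Submodule K A) (_hJ : IsIdeal J) : Type v := A ⧸ J

section QuotAlg

variable {K : Type u} {A : Type v} [Field K] [NonUnitalNonAssocRing A] [Module K A]
  (J : Submodule K A) (hJ : IsIdeal J)

instance : AddCommGroup (QuotAlg J hJ) := inferInstanceAs (AddCommGroup (A ⧸ J))

instance : Module K (QuotAlg J hJ) := inferInstanceAs (Module K (A ⧸ J))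

/-- The canonical projection onto the quotient. -/
def QuotAlg.proj : A →ₗ[K] QuotAlg J hJ := J.mkQ

theorem QuotAlg.proj_surjective : Function.Surjective (QuotAlg.proj J hJ) :=
  Submodule.mkQ_surjective J

theorem QuotAlg.proj_eq_proj_iff (x y : A) :
    QuotAlg.proj J hJ x = QuotAlg.proj J hJ y ↔ x - y ∈ J :=
  Submodule.Quotient.eq J

instance : Mul (QuotAlg J hJ) :=
  ⟨fun x y => Quotient.liftOn₂' x y (fun a b => QuotAlg.proj J hJ (a * b)) (by
    intro a₁ b₁ a₂ b₂ ha hb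
    have ha' : a₁ - a₂ ∈ J := (Submodule.quotientRel_def J).1 ha
    have hb' : b₁ - b₂ ∈ J := (Submodule.quotientRel_def J).1 hb
    rw [QuotAlg.proj_eq_proj_iff]
    have h : a₁ * b₁ - a₂ * b₂ = (a₁ - a₂) * b₁ + a₂ * (b₁ - b₂) := by
      rw [sub_mul, mul_sub]; abel
    rw [h]
    exact J.add_mem (hJ _ _ ha').2 (hJ _ _ hb').1)⟩

theorem QuotAlg.proj_mul (a b : A) :
    QuotAlg.proj J hJ (a * b) = QuotAlg.proj J hJ a * QuotAlg.proj J hJ b := rfl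

instance : NonUnitalNonAssocRing (QuotAlg J hJ) :=
  { (inferInstance : AddCommGroup (QuotAlg J hJ)), (inferInstance : Mul (QuotAlg J hJ)) with
    left_distrib := fun x y z => by
      obtain ⟨a, rfl⟩ := QuotAlg.proj_surjective J hJ x
      obtain ⟨b, rfl⟩ := QuotAlg.proj_surjective J hJ y
      obtain ⟨c, rfl⟩ := QuotAlg.proj_surjective J hJ z
      simp only [← map_add, ← QuotAlg.proj_mul, mul_add]
    right_distrib := fun x y z => by
      obtain ⟨a, rfl⟩ := QuotAlg.proj_surjective J hJ x
      obtain ⟨b, rfl⟩ := QuotAlg.proj_surjective J hJ y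
      obtain ⟨c, rfl⟩ := QuotAlg.proj_surjective J hJ z
      simp only [← map_add, ← QuotAlg.proj_mul, add_mul]
    zero_mul := fun x => by
      obtain ⟨a, rfl⟩ := QuotAlg.proj_surjective J hJ x
      rw [← map_zero (QuotAlg.proj J hJ), ← QuotAlg.proj_mul, zero_mul]
    mul_zero := fun x => by
      obtain ⟨a, rfl⟩ := QuotAlg.proj_surjective J hJ x
      rw [← map_zero (QuotAlg.proj J hJ), ← QuotAlg.proj_mul, mul_zero] }

instance [IsScalarTower K A A] : IsScalarTower K (QuotAlg J hJ) (QuotAlg J hJ) :=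
  ⟨fun c x y => by
    obtain ⟨a, rfl⟩ := QuotAlg.proj_surjective J hJ x
    obtain ⟨b, rfl⟩ := QuotAlg.proj_surjective J hJ y
    simp only [smul_eq_mul, ← map_smul, ← QuotAlg.proj_mul, smul_mul_assoc]⟩

instance [SMulCommClass K A A] : SMulCommClass K (QuotAlg J hJ) (QuotAlg J hJ) :=
  ⟨fun c x y => by
    obtain ⟨a, rfl⟩ := QuotAlg.proj_surjective J hJ x
    obtain ⟨b, rfl⟩ := QuotAlg.proj_surjective J hJ y
    simp only [smul_eq_mul, ← map_smul, ← QuotAlg.proj_mul, mul_smul_comm]⟩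

end QuotAlg

/-! ### Natural bases, nilpotency, solvability, subalgebra lattice -/

section Basic

variable {K : Type u} {A : Type v} [Field K] [NonUnitalNonAssocRing A] [Module K A]

/-- A basis is natural if distinct basis vectors multiply to zero. -/
def IsNatural {ι : Type*} (b : Module.Basis ι K A) : Prop :=
  ∀ i j, i ≠ j → b i * b j = 0

/-- The structure matrix: its row `i` holds the coordinates of `b i * b i`. -/
noncomputable def structureMatrix {ι : Type*} (b : Module.Basis ι K A) : Matrix ι ι K :=
  Matrix.of fun i k => b.repr (b i * b i) k

/-- The defining basis of `EvAlg M`. -/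
noncomputable def EvAlg.stdBasis {ι : Type v} [Fintype ι] (M : Matrix ι ι K) : Module.Basis ι K (EvAlg M) :=
  Module.Basis.ofEquivFun (LinearEquiv.refl K (ι → K))

theorem EvAlg.stdBasis_apply {ι : Type v} [Fintype ι] [DecidableEq ι] (M : Matrix ι ι K)
    (i j : ι) : (EvAlg.stdBasis M i) j = (Pi.single i 1 : ι → K) j := by
  have e := Module.Basis.coe_ofEquivFun (LinearEquiv.refl K (ι → K))
  exact congrFun (congrFun e i) j

theorem EvAlg.stdBasis_isNatural {ι : Type v} [Fintype ι] (M : Matrix ι ι K) :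
    IsNatural (EvAlg.stdBasis M) := by
  classical
  intro i j hij
  funext k
  rw [EvAlg.mul_apply, EvAlg.zero_apply]
  refine Finset.sum_eq_zero fun l _ => ?_
  rw [EvAlg.stdBasis_apply, EvAlg.stdBasis_apply]
  by_cases h : l = i
  · subst h; simp [hij]
  · simp [h]

theorem EvAlg.structureMatrix_stdBasis {ι : Type v} [Fintype ι] (M : Matrix ι ι K) :
    structureMatrix (EvAlg.stdBasis M) = M := by
  classical
  ext i k
  have h : structureMatrix (EvAlg.stdBasis M) i k =
      (EvAlg.stdBasis M i * EvAlg.stdBasis M i) k := rfl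
  rw [h, EvAlg.mul_apply, Finset.sum_eq_single i]
  · simp [EvAlg.stdBasis_apply]
  · intro l _ hl
    simp [EvAlg.stdBasis_apply, hl]
  · simp

variable (K A) in
/-- A finite-dimensional evolution algebra: one that has a finite natural basis. -/
def IsEvolution : Prop :=
  ∃ (n : ℕ) (b : Module.Basis (Fin n) K A), IsNatural b

variable [IsScalarTower K A A] [SMulCommClass K A A]

/-- The product of two subspaces: the span of the products of their elements. -/
def prod (P Q : Submodule K A) : Submodule K A := Submodule.map₂ (LinearMap.mul K A) P Q

variable (K A)

/-- The powers `A^1 = A`, `A^(k+1) = ∑_{i=1}^{k} A^i A^(k+1-i)`; the index `0` is not used. -/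
def power : ℕ → Submodule K A
  | 0 => ⊤
  | 1 => ⊤
  | k + 2 => ⨆ j : Fin (k + 1), prod (power (j.1 + 1)) (power (k + 1 - j.1))

/-- The derived series `A^(1) = A`, `A^(k+1) = A^(k) A^(k)`; the index `0` is not used. -/
def derived : ℕ → Submodule K A
  | 0 => ⊤
  | 1 => ⊤
  | k + 2 => prod (derived (k + 1)) (derived (k + 1))

def IsNilp : Prop := ∃ n, 1 ≤ n ∧ power K A n = ⊥

def IsSolv : Prop := ∃ n, 1 ≤ n ∧ derived K A n = ⊥

/-- The index of nilpotency, meaningful for nilpotent algebras. -/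
noncomputable def nilIndex : ℕ := sInf {n | 1 ≤ n ∧ power K A n = ⊥}

/-- The index of solvability, meaningful for solvable algebras. -/
noncomputable def solvIndex : ℕ := sInf {n | 1 ≤ n ∧ derived K A n = ⊥}

/-- `A` is a nilpotent evolution algebra whose index of nilpotency is the largest among
all nilpotent evolution algebras over `K` of the same dimension. -/
def HasMaxNilIndex : Prop :=
  IsEvolution K A ∧ IsNilp K A ∧
    ∀ M : Matrix (Fin (Module.finrank K A)) (Fin (Module.finrank K A)) K,
      IsNilp K (EvAlg M) → nilIndex K (EvAlg M) ≤ nilIndex K A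

/-- `A` is a solvable evolution algebra whose index of solvability is the largest among
all solvable evolution algebras over `K` of the same dimension. -/
def HasMaxSolvIndex : Prop :=
  IsEvolution K A ∧ IsSolv K A ∧
    ∀ M : Matrix (Fin (Module.finrank K A)) (Fin (Module.finrank K A)) K,
      IsSolv K (EvAlg M) → solvIndex K (EvAlg M) ≤ solvIndex K A

/-- Distributivity of the subalgebra lattice. -/
def IsDistributive : Prop :=
  ∀ U V W : NonUnitalSubalgebra K A, U ⊔ (V ⊓ W) = (U ⊔ V) ⊓ (U ⊔ W)

/-- Modularity of the subalgebra lattice. -/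
def IsModular : Prop :=
  ∀ U V W : NonUnitalSubalgebra K A, U ≤ W → U ⊔ (V ⊓ W) = (U ⊔ V) ⊓ W

/-- Upper semimodularity: `U` is maximal in `⟨U, V⟩` whenever `U ∩ V` is maximal in `V`. -/
def IsUpperSemimodular : Prop :=
  ∀ U V : NonUnitalSubalgebra K A, U ⊓ V ⋖ V → U ⋖ U ⊔ V

end Basic

/-- Isomorphism of algebras. -/
def Isomorphic (K : Type u) (A : Type*) (B : Type*) [Field K] [NonUnitalNonAssocRing A]
    [Module K A] [NonUnitalNonAssocRing B] [Module K B] : Prop :=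
  ∃ f : A →ₙₐ[K] B, Function.Bijective f

/-! ### The algebras `E_k(λ_1, …, λ_n)` and the family `F(E_1, …, E_r)` -/

section Family

variable {K : Type u} [Field K]

/-- The structure matrix of `E_k(λ_1, …, λ_n)`: `e_i ^ 2 = λ_i (e_1 + ⋯ + e_k)`. -/
def ekMatrix {n : ℕ} (k : ℕ) (lam : Fin n → K) : Matrix (Fin n) (Fin n) K :=
  Matrix.of fun i j => if j.1 < k then lam i else 0

/-- The conditions on the parameters of `E_k(λ_1, …, λ_n)`: `1 ≤ k ≤ n`, the `λ_i` are not
all zero, and `λ_1 + ⋯ + λ_k = 0`. -/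
def IsEkParam {n : ℕ} (k : ℕ) (lam : Fin n → K) : Prop :=
  1 ≤ k ∧ k ≤ n ∧ (∃ i, lam i ≠ 0) ∧ ∑ i : Fin n with i.1 < k, lam i = 0

/-- The algebra `E_k(λ_1, …, λ_n)`. -/
abbrev Ek {n : ℕ} (k : ℕ) (lam : Fin n → K) : Type u := EvAlg (ekMatrix k lam)

variable {A : Type v} [NonUnitalNonAssocRing A] [Module K A]

/-- `B` is a natural basis, indexed by the disjoint union of the index sets of the natural bases
of the `E_i = E_{k i}(lam i)` and `p` further indices, in which the structure matrix has the block
form `(D, 0; C, L)`, where `D` is block diagonal with the structure matrices of the `E_i`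
as blocks, `L` is strictly lower triangular and `C` is arbitrary. An algebra belongs to
`F(E_1, …, E_r)` if it has such a basis. -/
def IsFamilyBasis {r : ℕ} {d : Fin r → ℕ} (k : Fin r → ℕ) (lam : ∀ i, Fin (d i) → K) {p : ℕ}
    (B : Module.Basis ((Σ i : Fin r, Fin (d i)) ⊕ Fin p) K A) : Prop :=
  IsNatural B ∧
    ∃ (C : Matrix (Fin p) (Σ i : Fin r, Fin (d i)) K) (L : Matrix (Fin p) (Fin p) K),
      (∀ i j, i ≤ j → L i j = 0) ∧
      structureMatrix B =
        Matrix.fromBlocks (Matrix.blockDiagonal' fun i => ekMatrix (k i) (lam i)) 0 C L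

/-- The copy of `E_i` inside an algebra of the family: the span of its part of the basis. -/
def block {r : ℕ} {d : Fin r → ℕ} {p : ℕ}
    (B : Module.Basis ((Σ i : Fin r, Fin (d i)) ⊕ Fin p) K A) (i : Fin r) : Submodule K A :=
  Submodule.span K (Set.range fun a : Fin (d i) => B (Sum.inl ⟨i, a⟩))

variable [IsScalarTower K A A] [SMulCommClass K A A]

/-- The square of the copy of `E_i` is an ideal. -/
theorem blockSq_isIdeal {r : ℕ} {d : Fin r → ℕ} {k : Fin r → ℕ} {lam : ∀ i, Fin (d i) → K}
    {p : ℕ} {B : Module.Basis ((Σ i : Fin r, Fin (d i)) ⊕ Fin p) K A}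
    (hB : IsFamilyBasis k lam B) (i : Fin r) : IsIdeal (prod (block B i) (block B i)) := by
  obtain ⟨hnat, C, L, -, hM⟩ := hB
  -- a basis vector times an element of the block is a product of two elements of the block
  have key : ∀ s, ∀ x ∈ block B i, B s * x ∈ prod (block B i) (block B i) ∧
      x * B s ∈ prod (block B i) (block B i) := by
    intro s x hx
    by_cases hs : ∃ a : Fin (d i), s = Sum.inl ⟨i, a⟩
    · obtain ⟨a, rfl⟩ := hs
      have hm : B (Sum.inl ⟨i, a⟩) ∈ block B i := Submodule.subset_span ⟨a, rfl⟩
      exact ⟨Submodule.apply_mem_map₂ (LinearMap.mul K A) hm hx,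
        Submodule.apply_mem_map₂ (LinearMap.mul K A) hx hm⟩
    · suffices h : B s * x = 0 ∧ x * B s = 0 by
        rw [h.1, h.2]; exact ⟨zero_mem _, zero_mem _⟩
      refine Submodule.span_induction ?_ ?_ ?_ ?_ hx
      · rintro _ ⟨a, rfl⟩
        exact ⟨hnat _ _ fun h => hs ⟨a, h⟩, hnat _ _ fun h => hs ⟨a, h.symm⟩⟩
      · simp
      · rintro x y - - ⟨h1, h2⟩ ⟨h3, h4⟩
        simp [mul_add, add_mul, h1, h2, h3, h4]
      · rintro c x - ⟨h1, h2⟩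
        simp [mul_smul_comm, smul_mul_assoc, h1, h2]
  have all : ∀ a : A, ∀ x ∈ block B i, a * x ∈ prod (block B i) (block B i) ∧
      x * a ∈ prod (block B i) (block B i) := by
    intro a x hx
    refine Submodule.span_induction ?_ ?_ ?_ ?_ (B.mem_span a)
    · rintro _ ⟨s, rfl⟩
      exact key s x hx
    · simp
    · rintro y z - - ⟨h1, h2⟩ ⟨h3, h4⟩
      rw [add_mul, mul_add]
      exact ⟨add_mem h1 h3, add_mem h2 h4⟩
    · rintro c y - ⟨h1, h2⟩
      rw [smul_mul_assoc, mul_smul_comm]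
      exact ⟨Submodule.smul_mem _ c h1, Submodule.smul_mem _ c h2⟩
  have sq : ∀ a : Fin (d i), B (Sum.inl ⟨i, a⟩) * B (Sum.inl ⟨i, a⟩) ∈ block B i := by
    intro a
    rw [← B.sum_repr (B (Sum.inl ⟨i, a⟩) * B (Sum.inl ⟨i, a⟩))]
    refine Submodule.sum_mem _ fun s _ => ?_
    have hs : B.repr (B (Sum.inl ⟨i, a⟩) * B (Sum.inl ⟨i, a⟩)) s =
        structureMatrix B (Sum.inl ⟨i, a⟩) s := rfl
    rw [hs, hM]
    rcases s with ⟨j, c⟩ | t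
    · by_cases hij : i = j
      · subst hij
        exact Submodule.smul_mem _ _ (Submodule.subset_span ⟨c, rfl⟩)
      · simp [Matrix.blockDiagonal'_apply_ne _ _ _ hij]
    · simp
  have le : prod (block B i) (block B i) ≤ block B i := by
    refine (Submodule.map₂_span_span K (LinearMap.mul K A) _ _).le.trans ?_
    refine Submodule.span_le.2 ?_
    rintro _ ⟨_, ⟨a, rfl⟩, _, ⟨c, rfl⟩, rfl⟩
    by_cases hac : a = c
    · subst hac; exact sq a
    · have : B (Sum.inl ⟨i, a⟩) * B (Sum.inl ⟨i, c⟩) = 0 :=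
        hnat _ _ fun h => hac (by simpa using h)
      simp [this]
  exact fun a x hx => all a x (le hx)

end Family

end EvoAlg

open EvoAlg

/-!
The theorem is proved by passing every condition through one notion, that of a regular flag basis.

If the algebra has a single block, of dimension two, then after a scaling its first two basis
vectors satisfy `e_1 ^ 2 = e_1 + e_2 = - e_2 ^ 2`. The vectors `u = e_1 + e_2`,
`w = (e_1 - e_2) / 2` and the remaining basis vectors form a flag basis (`IsFlagBasis`):
`u ^ 2 = w ^ 2 = 0`, `u w = u`, the other mixed products vanish, and the square of each `b_i` with
`i ≥ 2` lies in the span of its predecessors. It is regular (`IsRegular`) if that square always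
involves the immediate predecessor. This is the same as `dim A ^ 2 ≥ dim A - 1`
(`IsFlagBasis.isRegular_of_finrank_le` is the direction that takes an argument).

*Indices.* Strictly decreasing chains give `solvIndex ≤ dim A ^ 2 + 2` and
`nilIndex ≤ 2 ^ dim A ^ 2 + 1` in every algebra (`solvIndex_le`, `nilIndex_le`), and the chain
algebra `e_(i+1) ^ 2 = e_i` shows that the maxima over dimension `n` are `n + 1` and
`2 ^ (n - 1) + 1`. So a maximum index forces `dim A ^ 2 ≥ dim A - 1`. For the index of solvability
this leaves room for only one block, of dimension two, as the square of an algebra with `r` blocks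
and `p` further basis vectors has dimension at most `r + p`. Conversely, in a regular flag basis
each term of the flag lies in the square of the next (`IsFlagBasis.flag_le_prod`), so both the
algebra and its quotient by `K u` reach the maximum.

*Distributivity.* In a regular flag basis, squaring a vector lowers its top index by one. Hence a
subalgebra either contains `u` or lies in the hyperplane complementary to `u`, and its intersection
with this hyperplane is determined by the largest top index occurring in it
(`IsFlagBasis.zero_mem_or`, `IsFlagBasis.mem_of_top`). The subalgebra lattice is thus a sublattice
of the product of a two-element chain and a chain.

*Modularity.* All failures of modularity come from one pentagon (`not_isModular_of_pentagon`). It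
occurs as soon as a hyperbolic pair `u`, `w` is accompanied by an independent vector `z` with `u z`,
`w z` and `z ^ 2` in `K u` (`not_isModular_of_hyperbolic`), which rules out a second block, and a
block of dimension at least three. It also occurs modulo a term of the flag when two basis vectors
`b_i`, `b_l` have squares with the same top index: since the field is quadratically closed, some
combinations `b_i ± t b_l` with `t ≠ 0` have square zero there
(`IsFlagBasis.isRegular_of_isModular`).
-/

namespace EvoAlg

/-! ### Powers and derived series -/

section Series

variable {K : Type u} {A : Type v} [Field K] [NonUnitalNonAssocRing A] [Module K A]
  [IsScalarTower K A A] [SMulCommClass K A A]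

theorem mul_mem_prod {P Q : Submodule K A} {x y : A} (hx : x ∈ P) (hy : y ∈ Q) :
    x * y ∈ prod P Q :=
  Submodule.apply_mem_map₂ (LinearMap.mul K A) hx hy

theorem prod_le {P Q R : Submodule K A} :
    prod P Q ≤ R ↔ ∀ x ∈ P, ∀ y ∈ Q, x * y ∈ R :=
  Submodule.map₂_le

theorem prod_mono {P P' Q Q' : Submodule K A} (hP : P ≤ P') (hQ : Q ≤ Q') :
    prod P Q ≤ prod P' Q' :=
  Submodule.map₂_le_map₂ hP hQ

/-- The square of the whole algebra is spanned by the squares of a natural basis. -/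
theorem prod_top_top_eq_span {ι : Type*} {b : Module.Basis ι K A} (hb : IsNatural b) :
    prod (⊤ : Submodule K A) ⊤ = Submodule.span K (Set.range fun i => b i * b i) := by
  apply le_antisymm
  · rw [← b.span_eq]
    refine (Submodule.map₂_span_span K (LinearMap.mul K A) _ _).le.trans
      (Submodule.span_le.2 ?_)
    rintro _ ⟨_, ⟨i, rfl⟩, _, ⟨j, rfl⟩, rfl⟩
    by_cases hij : i = j
    · subst hij
      exact Submodule.subset_span ⟨i, rfl⟩
    · simp [hb i j hij]
  · rw [Submodule.span_le]
    rintro _ ⟨i, rfl⟩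
    exact mul_mem_prod trivial trivial

/-- The rank of the structure matrix in a natural basis is the dimension of the square. -/
theorem rank_structureMatrix {ι : Type*} [Fintype ι] {b : Module.Basis ι K A}
    (hb : IsNatural b) :
    (structureMatrix b).rank = Module.finrank K (prod (⊤ : Submodule K A) ⊤) := by
  rw [Matrix.rank_eq_finrank_span_row, prod_top_top_eq_span hb,
    ← LinearEquiv.finrank_map_eq b.equivFun, Submodule.map_span, ← Set.range_comp]
  rfl

variable (K A)

theorem power_one : power K A 1 = ⊤ := by rw [power]

theorem power_two : power K A 2 = prod ⊤ ⊤ := by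
  rw [power]
  simp [power_one]

theorem derived_one : derived K A 1 = ⊤ := by rw [derived]

theorem derived_succ {k : ℕ} (hk : 1 ≤ k) :
    derived K A (k + 1) = prod (derived K A k) (derived K A k) := by
  obtain ⟨k, rfl⟩ := Nat.exists_eq_add_of_le' hk
  rw [derived]

theorem prod_power_le {a b : ℕ} (ha : 1 ≤ a) (hb : 1 ≤ b) :
    prod (power K A a) (power K A b) ≤ power K A (a + b) := by
  obtain ⟨a, rfl⟩ := Nat.exists_eq_add_of_le' ha
  obtain ⟨b, rfl⟩ := Nat.exists_eq_add_of_le' hb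
  have e : a + 1 + (b + 1) = a + b + 2 := by omega
  rw [e, power]
  have h := le_iSup (fun j : Fin (a + b + 1) =>
    prod (power K A (j.1 + 1)) (power K A (a + b + 1 - j.1))) ⟨a, by omega⟩
  have e' : a + b + 1 - a = b + 1 := by omega
  simpa only [e'] using h

theorem power_le {m : ℕ} (hm : 2 ≤ m) {S : Submodule K A}
    (h : ∀ a b, 1 ≤ a → 1 ≤ b → a + b = m → prod (power K A a) (power K A b) ≤ S) :
    power K A m ≤ S := by
  obtain ⟨m, rfl⟩ := Nat.exists_eq_add_of_le' hm
  rw [power]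
  exact iSup_le fun j => h _ _ (by omega) (by omega) (by omega)

theorem power_succ_le {m : ℕ} : 1 ≤ m → power K A (m + 1) ≤ power K A m := by
  induction m using Nat.strong_induction_on with
  | _ m ih =>
    intro hm
    rcases Nat.eq_or_lt_of_le hm with rfl | hm
    · rw [power_one]; exact le_top
    refine power_le K A (by omega) fun a b ha hb hab => ?_
    rcases Nat.eq_or_lt_of_le ha with rfl | ha
    · have h := prod_mono (le_refl (power K A 1)) (ih (b - 1) (by omega) (by omega))
      rw [Nat.sub_add_cancel hb] at h
      refine h.trans ((prod_power_le K A le_rfl (by omega)).trans (le_of_eq ?_))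
      congr 1; omega
    · have h := prod_mono (ih (a - 1) (by omega) (by omega)) (le_refl (power K A b))
      rw [Nat.sub_add_cancel ha.le] at h
      refine h.trans ((prod_power_le K A (by omega) hb).trans (le_of_eq ?_))
      congr 1; omega

theorem power_antitone {m n : ℕ} (hm : 1 ≤ m) (hmn : m ≤ n) : power K A n ≤ power K A m := by
  induction n, hmn using Nat.le_induction with
  | base => exact le_rfl
  | succ n hn ih => exact (power_succ_le K A (hm.trans hn)).trans ih

theorem derived_antitone {m n : ℕ} (hm : 1 ≤ m) (hmn : m ≤ n) :
    derived K A n ≤ derived K A m := by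
  have step : ∀ k, 1 ≤ k → derived K A (k + 1) ≤ derived K A k := by
    intro k hk
    induction k, hk using Nat.le_induction with
    | base => rw [derived_one]; exact le_top
    | succ k hk ih =>
      rw [derived_succ K A (k := k + 1) (by omega)]
      exact (prod_mono ih ih).trans (derived_succ K A hk).ge
  induction n, hmn using Nat.le_induction with
  | base => exact le_rfl
  | succ n hn ih => exact (step n (hm.trans hn)).trans ih

variable {K A}

theorem IsNilp.isSolv (h : IsNilp K A) : IsSolv K A := by
  have key : ∀ k, 1 ≤ k → derived K A k ≤ power K A k := by
    intro k hk
    induction k, hk using Nat.le_induction with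
    | base => rw [power_one]; exact le_top
    | succ k hk ih =>
      rw [derived_succ K A hk]
      exact (prod_mono ih ih).trans ((prod_power_le K A hk hk).trans
        (power_antitone K A (by omega) (by omega)))
  obtain ⟨n, hn, h⟩ := h
  exact ⟨n, hn, le_bot_iff.1 ((key n hn).trans h.le)⟩

theorem lt_solvIndex (h : IsSolv K A) {n : ℕ} (hn : derived K A n ≠ ⊥) :
    n < solvIndex K A := by
  by_contra! hle
  obtain ⟨h1, h2⟩ := Nat.sInf_mem h
  exact hn (le_bot_iff.1 ((derived_antitone K A h1 hle).trans h2.le))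

theorem lt_nilIndex (h : IsNilp K A) {n : ℕ} (hn : power K A n ≠ ⊥) :
    n < nilIndex K A := by
  by_contra! hle
  obtain ⟨h1, h2⟩ := Nat.sInf_mem h
  exact hn (le_bot_iff.1 ((power_antitone K A h1 hle).trans h2.le))

/-- A chain of subspaces that decreases strictly until it vanishes vanishes after as many steps as
the dimension of its first term. -/
theorem eq_bot_of_strict_chain {A : Type v} [AddCommGroup A] [Module K A]
    [FiniteDimensional K A] (P : ℕ → Submodule K A)
    (h : ∀ j, P j ≠ ⊥ → P (j + 1) < P j) (h0 : ∀ j, P j = ⊥ → P (j + 1) = ⊥) :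
    P (Module.finrank K (P 0)) = ⊥ := by
  have key : ∀ j, P j = ⊥ ∨ Module.finrank K (P j) + j ≤ Module.finrank K (P 0) := by
    intro j
    induction j with
    | zero => exact Or.inr le_rfl
    | succ j ih =>
      by_cases hj : P j = ⊥
      · exact Or.inl (h0 j hj)
      · have := Submodule.finrank_lt_finrank_of_lt (h j hj)
        have := ih.resolve_left hj
        right; omega
  rcases key (Module.finrank K (P 0)) with h | h
  · exact h
  · exact Submodule.finrank_eq_zero.1 (by omega)

/-- The derived series decreases strictly until it vanishes. -/
theorem solvIndex_le [FiniteDimensional K A] (h : IsSolv K A) :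
    solvIndex K A ≤ Module.finrank K (prod (⊤ : Submodule K A) ⊤) + 2 := by
  have e : prod (⊤ : Submodule K A) ⊤ = derived K A (0 + 2) := by
    rw [derived_succ K A le_rfl, derived_one]
  rw [e]
  refine Nat.sInf_le ⟨by omega, eq_bot_of_strict_chain (fun j => derived K A (j + 2))
    (fun j hj => lt_of_le_of_ne (derived_antitone K A (by omega) (by omega)) fun heq => hj ?_)
    fun j hj => le_bot_iff.1 ((derived_antitone K A (by omega) (by omega)).trans hj.le)⟩
  have stable : ∀ n, j + 2 ≤ n → derived K A n = derived K A (j + 2) := by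
    intro n hn
    induction n, hn using Nat.le_induction with
    | base => rfl
    | succ n hn ih =>
      rw [derived_succ K A (by omega), ih, ← derived_succ K A (by omega)]
      exact heq
  obtain ⟨n, hn, h⟩ := h
  rw [← stable (n + j + 2) (by omega)]
  exact le_bot_iff.1 ((derived_antitone K A hn (by omega)).trans h.le)

/-- One of two indices with sum `2 ^ (j + 1) + 1` is at least `2 ^ j + 1`. -/
theorem power_two_pow_succ_le (j : ℕ) :
    power K A (2 ^ (j + 1) + 1) ≤
      prod (power K A (2 ^ j + 1)) ⊤ ⊔ prod ⊤ (power K A (2 ^ j + 1)) := by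
  have hj : 1 ≤ 2 ^ j := Nat.one_le_two_pow
  have hs : 2 ^ (j + 1) = 2 * 2 ^ j := by ring
  refine power_le K A (by omega) fun a b ha hb hab => ?_
  by_cases h : 2 ^ j + 1 ≤ a
  · exact (prod_mono (power_antitone K A (by omega) h) le_top).trans le_sup_left
  · exact (prod_mono le_top (power_antitone K A (by omega) (by omega))).trans le_sup_right

/-- The subspaces `A ^ (2 ^ j + 1)` decrease strictly until they vanish. -/
theorem nilIndex_le [FiniteDimensional K A] (h : IsNilp K A) :
    nilIndex K A ≤ 2 ^ Module.finrank K (prod (⊤ : Submodule K A) ⊤) + 1 := by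
  have e : prod (⊤ : Submodule K A) ⊤ = power K A (2 ^ 0 + 1) := (power_two K A).symm
  have anti : ∀ j, power K A (2 ^ (j + 1) + 1) ≤ power K A (2 ^ j + 1) := fun j =>
    power_antitone K A (Nat.le_add_left 1 _)
      (Nat.add_le_add_right (Nat.pow_le_pow_right (by norm_num) (by omega)) 1)
  rw [e]
  refine Nat.sInf_le ⟨Nat.le_add_left 1 _, eq_bot_of_strict_chain (fun j => power K A (2 ^ j + 1))
    (fun j hj => lt_of_le_of_ne (anti j) fun heq => hj ?_)
    fun j hj => le_bot_iff.1 ((anti j).trans hj.le)⟩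
  -- a subspace `P ≤ P A + A P` lies in every power of `A`
  have le : ∀ n, 1 ≤ n → power K A (2 ^ j + 1) ≤ power K A n := by
    intro n hn
    induction n, hn using Nat.le_induction with
    | base => rw [power_one]; exact le_top
    | succ n hn ih =>
      refine heq.ge.trans ((power_two_pow_succ_le j).trans (sup_le ?_ ?_))
      · exact (prod_mono ih (power_one K A).ge).trans (prod_power_le K A hn le_rfl)
      · refine (prod_mono (power_one K A).ge ih).trans
          ((prod_power_le K A le_rfl hn).trans (le_of_eq ?_))
        rw [add_comm]
  obtain ⟨n, hn, h⟩ := h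
  exact le_bot_iff.1 ((le n hn).trans h.le)

theorem finrank_prod_top_top_lt [FiniteDimensional K A] (h : IsSolv K A)
    (hA : 0 < Module.finrank K A) :
    Module.finrank K (prod (⊤ : Submodule K A) ⊤) < Module.finrank K A := by
  refine Submodule.finrank_lt fun heq => ?_
  have stable : ∀ n, 1 ≤ n → derived K A n = ⊤ := by
    intro n hn
    induction n, hn using Nat.le_induction with
    | base => exact derived_one K A
    | succ n hn ih => rw [derived_succ K A hn, ih, heq]
  obtain ⟨n, hn, h⟩ := h
  rw [stable n hn] at h
  rw [← finrank_top K A, h, finrank_bot] at hA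
  exact lt_irrefl _ hA

/-- A finite filtration of which each term multiplies the algebra into the term below. With
truncated subtraction, `A ^ (2 ^ j + 1)` lies in `V (n - 1 - j)`. -/
theorem IsNilp.of_filtration {n : ℕ} (V : ℕ → Submodule K A) (h0 : V 0 = ⊥) (hn : V n = ⊤)
    (h : ∀ i, prod (V (i + 1)) ⊤ ≤ V i ∧ prod ⊤ (V (i + 1)) ≤ V i) : IsNilp K A := by
  have key : ∀ j, power K A (2 ^ j + 1) ≤ V (n - 1 - j) := by
    intro j
    induction j with
    | zero =>
      rw [pow_zero, power_two]
      rcases Nat.eq_zero_or_pos n with rfl | hpos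
      · rw [prod_le]
        intro x _ y _
        have hx : x ∈ V 0 := hn ▸ Submodule.mem_top
        rw [h0, Submodule.mem_bot] at hx
        simp [hx]
      · have := (h (n - 1)).1
        rw [Nat.sub_add_cancel hpos, hn] at this
        exact this
    | succ j ih =>
      refine (power_two_pow_succ_le j).trans ?_
      refine (sup_le_sup (prod_mono ih le_rfl) (prod_mono le_rfl ih)).trans ?_
      rcases Nat.eq_zero_or_pos (n - 1 - j) with hz | hpos
      · rw [hz, h0]
        refine sup_le (prod_le.2 fun x hx y _ => ?_) (prod_le.2 fun x _ y hy => ?_)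
        · rw [(Submodule.mem_bot K).1 hx, zero_mul]; exact zero_mem _
        · rw [(Submodule.mem_bot K).1 hy, mul_zero]; exact zero_mem _
      · obtain ⟨i, hi⟩ := Nat.exists_eq_add_of_le' hpos
        have e : n - 1 - (j + 1) = i := by omega
        rw [hi, e]
        exact sup_le (h i).1 (h i).2
  refine ⟨2 ^ n + 1, Nat.le_add_left 1 _, le_bot_iff.1 ((key n).trans ?_)⟩
  rw [show n - 1 - n = 0 by omega, h0]

/-- A filtration each of whose terms lies in the square of the next bounds the derived series from
below, one step at a time. -/
theorem le_derived_of_filtration {n : ℕ} {V : ℕ → Submodule K A}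
    (h : ∀ i, i + 1 ≤ n → V i ≤ prod (V (i + 1)) (V (i + 1))) {k : ℕ} (hk : k ≤ n) :
    V (n - k) ≤ derived K A (k + 1) := by
  induction k with
  | zero => rw [derived_one]; exact le_top
  | succ k ih =>
    have h1 := h (n - (k + 1)) (by omega)
    rw [show n - (k + 1) + 1 = n - k by omega] at h1
    rw [derived_succ K A (by omega)]
    exact h1.trans (prod_mono (ih (by omega)) (ih (by omega)))

/-- A filtration each of whose terms lies in the square of the next bounds the powers from below,
each step doubling the exponent. -/
theorem le_power_of_filtration {n : ℕ} {V : ℕ → Submodule K A}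
    (h : ∀ i, i + 1 ≤ n → V i ≤ prod (V (i + 1)) (V (i + 1))) {k : ℕ} (hk : k ≤ n) :
    V (n - k) ≤ power K A (2 ^ k) := by
  induction k with
  | zero => rw [pow_zero, power_one]; exact le_top
  | succ k ih =>
    have h1 := h (n - (k + 1)) (by omega)
    rw [show n - (k + 1) + 1 = n - k by omega] at h1
    rw [pow_succ, mul_two]
    exact h1.trans ((prod_mono (ih (by omega)) (ih (by omega))).trans
      (prod_power_le K A Nat.one_le_two_pow Nat.one_le_two_pow))

theorem lt_solvIndex_of_filtration (hA : IsSolv K A) {n : ℕ} {V : ℕ → Submodule K A}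
    (h : ∀ i, i + 1 ≤ n → V i ≤ prod (V (i + 1)) (V (i + 1)))
    (h1 : 1 ≤ n) (hV : V 1 ≠ ⊥) : n < solvIndex K A := by
  refine lt_solvIndex hA fun hbot => hV (le_bot_iff.1 ?_)
  have := le_derived_of_filtration h (k := n - 1) (by omega)
  rwa [Nat.sub_add_cancel h1, hbot, show n - (n - 1) = 1 by omega] at this

theorem lt_nilIndex_of_filtration (hA : IsNilp K A) {n : ℕ} {V : ℕ → Submodule K A}
    (h : ∀ i, i + 1 ≤ n → V i ≤ prod (V (i + 1)) (V (i + 1)))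
    (h1 : 1 ≤ n) (hV : V 1 ≠ ⊥) : 2 ^ (n - 1) < nilIndex K A := by
  refine lt_nilIndex hA fun hbot => hV (le_bot_iff.1 ?_)
  have := le_power_of_filtration h (k := n - 1) (by omega)
  rwa [hbot, show n - (n - 1) = 1 by omega] at this

end Series

/-! ### The chain algebra -/

section Chain

variable (K : Type u) [Field K]

/-- The structure matrix of the nilpotent evolution algebra with `e_0 ^ 2 = 0` and
`e_(i+1) ^ 2 = e_i`, which has both indices as large as its dimension permits. -/
def chainMatrix (n : ℕ) : Matrix (Fin n) (Fin n) K :=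
  Matrix.of fun i j => if i.1 = j.1 + 1 then 1 else 0

/-- The subspace of the chain algebra of vectors supported on the first `i` coordinates. -/
def chainFlag (n i : ℕ) : Submodule K (EvAlg (chainMatrix K n)) where
  carrier := {x | ∀ j : Fin n, i ≤ j.1 → x j = 0}
  add_mem' hx hy j hj := by rw [EvAlg.add_apply, hx j hj, hy j hj, add_zero]
  zero_mem' _ _ := rfl
  smul_mem' c x hx j hj := by rw [EvAlg.smul_apply, hx j hj, mul_zero]

theorem chain_mul_mem_chainFlag {n i : ℕ} {x y : EvAlg (chainMatrix K n)}
    (h : ∀ j : Fin n, i + 1 ≤ j.1 → x j * y j = 0) : x * y ∈ chainFlag K n i := by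
  intro j hj
  rw [EvAlg.mul_apply]
  refine Finset.sum_eq_zero fun l _ => ?_
  by_cases hl : l.1 = j.1 + 1
  · rw [h l (by omega), zero_mul]
  · simp [chainMatrix, hl]

theorem chain_isNilp (n : ℕ) : IsNilp K (EvAlg (chainMatrix K n)) := by
  refine IsNilp.of_filtration (n := n) (chainFlag K n) ?_ ?_ fun i => ⟨?_, ?_⟩
  · exact eq_bot_iff.2 fun x hx => (Submodule.mem_bot K).2 (funext fun j => hx j (Nat.zero_le _))
  · exact eq_top_iff.2 fun x _ j hj => absurd j.2 (by omega)
  · exact prod_le.2 fun x hx y _ => chain_mul_mem_chainFlag K fun j hj => by rw [hx j hj, zero_mul]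
  · exact prod_le.2 fun x _ y hy => chain_mul_mem_chainFlag K fun j hj => by rw [hy j hj, mul_zero]

theorem chainFlag_le {n i : ℕ} (hi : i + 1 ≤ n) :
    chainFlag K n i ≤ prod (chainFlag K n (i + 1)) (chainFlag K n (i + 1)) := by
  intro x hx
  -- `x` is the product of its shift with the shift of the vector of ones
  let y : EvAlg (chainMatrix K n) := fun j => if h : 1 ≤ j.1 then x ⟨j.1 - 1, by omega⟩ else 0
  let z : EvAlg (chainMatrix K n) := fun j => if j.1 ≤ i then (1 : K) else 0
  have hxy : x = y * z := by
    funext j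
    rw [EvAlg.mul_apply]
    by_cases hj : j.1 + 1 < n
    · rw [Finset.sum_eq_single (⟨j.1 + 1, hj⟩ : Fin n)]
      · by_cases hji : j.1 + 1 ≤ i
        · simp [y, z, chainMatrix, hji]
        · simp [y, z, chainMatrix, hji, hx j (by omega)]
      · intro l _ hl
        have : l.1 ≠ j.1 + 1 := fun h => hl (Fin.ext h)
        simp [chainMatrix, this]
      · simp
    · rw [hx j (by omega)]
      refine (Finset.sum_eq_zero fun l _ => ?_).symm
      have : l.1 ≠ j.1 + 1 := by omega
      simp [chainMatrix, this]
  rw [hxy]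
  refine mul_mem_prod (fun j hj => ?_) fun j hj => ?_
  · have h1 : 1 ≤ j.1 := by omega
    simp only [y, h1, dif_pos]
    exact hx _ (by simp only; omega)
  · simp only [z]
    rw [if_neg (by omega)]

theorem chainFlag_one_ne_bot {n : ℕ} (hn : 1 ≤ n) : chainFlag K n 1 ≠ ⊥ := by
  intro h
  let x : EvAlg (chainMatrix K n) := fun j => if j.1 = 0 then (1 : K) else 0
  have hx : x ∈ chainFlag K n 1 := fun j hj => by
    simp only [x]; rw [if_neg (by omega)]
  rw [h, Submodule.mem_bot] at hx
  have := congrFun hx ⟨0, hn⟩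
  simp [x, EvAlg.zero_apply] at this

theorem lt_solvIndex_chain {n : ℕ} (hn : 1 ≤ n) : n < solvIndex K (EvAlg (chainMatrix K n)) :=
  lt_solvIndex_of_filtration (chain_isNilp K n).isSolv (fun _ => chainFlag_le K) hn
    (chainFlag_one_ne_bot K hn)

theorem lt_nilIndex_chain {n : ℕ} (hn : 1 ≤ n) :
    2 ^ (n - 1) < nilIndex K (EvAlg (chainMatrix K n)) :=
  lt_nilIndex_of_filtration (chain_isNilp K n) (fun _ => chainFlag_le K) hn
    (chainFlag_one_ne_bot K hn)

end Chain

section MaxIndex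

variable {K : Type u} {A : Type v} [Field K] [NonUnitalNonAssocRing A] [Module K A]
  [IsScalarTower K A A] [SMulCommClass K A A]

theorem finrank_evAlg {n : ℕ} (M : Matrix (Fin n) (Fin n) K) :
    Module.finrank K (EvAlg M) = n := by
  rw [Module.finrank_eq_card_basis (EvAlg.stdBasis M), Fintype.card_fin]

theorem finiteDimensional_evAlg {n : ℕ} (M : Matrix (Fin n) (Fin n) K) :
    FiniteDimensional K (EvAlg M) :=
  Module.Basis.finiteDimensional_of_finite (EvAlg.stdBasis M)

/-- Comparison with the chain algebra. -/
theorem HasMaxSolvIndex.finrank_le [FiniteDimensional K A] (h : HasMaxSolvIndex K A) :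
    Module.finrank K A ≤ Module.finrank K (prod (⊤ : Submodule K A) ⊤) + 1 := by
  rcases Nat.eq_zero_or_pos (Module.finrank K A) with h0 | hpos
  · omega
  have h1 := lt_solvIndex_chain K hpos
  have h2 := h.2.2 _ (chain_isNilp K _).isSolv
  have h3 := solvIndex_le h.2.1
  omega

/-- Comparison with the chain algebra. -/
theorem HasMaxNilIndex.finrank_le [FiniteDimensional K A] (h : HasMaxNilIndex K A) :
    Module.finrank K A ≤ Module.finrank K (prod (⊤ : Submodule K A) ⊤) + 1 := by
  rcases Nat.eq_zero_or_pos (Module.finrank K A) with h0 | hpos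
  · omega
  have h1 := lt_nilIndex_chain K hpos
  have h2 := h.2.2 _ (chain_isNilp K _)
  have h3 := nilIndex_le h.2.1
  have h4 : 2 ^ (Module.finrank K A - 1) ≤ 2 ^ Module.finrank K (prod (⊤ : Submodule K A) ⊤) := by
    omega
  have := (Nat.pow_le_pow_iff_right (by norm_num)).1 h4
  omega

theorem hasMaxSolvIndex_of_lt (hE : IsEvolution K A) (hA : IsSolv K A)
    (hpos : 0 < Module.finrank K A) (h : Module.finrank K A < solvIndex K A) :
    HasMaxSolvIndex K A := by
  refine ⟨hE, hA, fun M hM => ?_⟩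
  have := finiteDimensional_evAlg M
  have h1 := solvIndex_le hM
  have h2 := finrank_prod_top_top_lt hM (by rwa [finrank_evAlg])
  rw [finrank_evAlg] at h2
  omega

theorem hasMaxNilIndex_of_lt (hE : IsEvolution K A) (hA : IsNilp K A)
    (hpos : 0 < Module.finrank K A) (h : 2 ^ (Module.finrank K A - 1) < nilIndex K A) :
    HasMaxNilIndex K A := by
  refine ⟨hE, hA, fun M hM => ?_⟩
  have := finiteDimensional_evAlg M
  have h1 := nilIndex_le hM
  have h2 := finrank_prod_top_top_lt hM.isSolv (by rwa [finrank_evAlg])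
  rw [finrank_evAlg] at h2
  have h3 : 2 ^ Module.finrank K (prod (⊤ : Submodule K (EvAlg M)) ⊤) ≤
      2 ^ (Module.finrank K A - 1) := Nat.pow_le_pow_right (by norm_num) (by omega)
  omega

end MaxIndex

/-! ### Flags of a basis -/

section Flag

variable {K : Type u} {A : Type v} [Field K] [AddCommGroup A] [Module K A]

/-- The span of the basis vectors of index less than `i`. -/
def flag {m : ℕ} (b : Module.Basis (Fin m) K A) (i : ℕ) : Submodule K A :=
  Submodule.span K (b '' {j | j.1 < i})

variable {m : ℕ} (b : Module.Basis (Fin m) K A)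

variable {b} in
theorem mem_flag {i : ℕ} {x : A} : x ∈ flag b i ↔ ∀ j : Fin m, i ≤ j.1 → b.repr x j = 0 := by
  rw [flag, b.mem_span_image]
  constructor
  · intro h j hj
    by_contra hne
    have : j.1 < i := h (Finsupp.mem_support_iff.2 hne)
    omega
  · intro h j hj
    by_contra hlt
    exact Finsupp.mem_support_iff.1 hj (h j (not_lt.1 hlt))

variable {b} in
theorem basis_mem_flag {i : ℕ} {j : Fin m} (h : j.1 < i) : b j ∈ flag b i :=
  Submodule.subset_span ⟨j, h, rfl⟩

theorem flag_zero : flag b 0 = ⊥ := by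
  simp [flag]

theorem flag_mono {i j : ℕ} (h : i ≤ j) : flag b i ≤ flag b j :=
  Submodule.span_mono (Set.image_mono fun _ hk => lt_of_lt_of_le hk h)

theorem flag_top : flag b m = ⊤ :=
  eq_top_iff.2 fun _ _ => mem_flag.2 fun j hj => absurd j.2 (by omega)

/-- A nonzero vector has a coordinate of largest index. -/
theorem exists_top_coord {x : A} (hx : x ≠ 0) :
    ∃ i : Fin m, b.repr x i ≠ 0 ∧ x ∈ flag b (i.1 + 1) := by
  have hs : (b.repr x).support.Nonempty := by
    rw [Finsupp.support_nonempty_iff]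
    simpa using hx
  refine ⟨_, Finsupp.mem_support_iff.1 (Finset.max'_mem _ hs), mem_flag.2 fun j hj => ?_⟩
  by_contra hne
  have := Finset.le_max' _ _ (Finsupp.mem_support_iff.2 hne)
  have : j.1 ≤ ((b.repr x).support.max' hs).1 := this
  omega

/-- Subtracting its term of largest index lowers a vector in the flag. -/
theorem sub_smul_mem_flag {i : Fin m} {x y : A} (hx : x ∈ flag b (i.1 + 1))
    (hxi : b.repr x i ≠ 0) (hy : y ∈ flag b (i.1 + 1)) :
    y - (b.repr y i / b.repr x i) • x ∈ flag b i.1 := by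
  rw [mem_flag] at *
  intro j hj
  rw [map_sub, map_smul, Finsupp.sub_apply, Finsupp.smul_apply, smul_eq_mul]
  rcases Nat.eq_or_lt_of_le hj with h | h
  · rw [← Fin.ext h, div_mul_cancel₀ _ hxi, sub_self]
  · rw [hx j h, hy j h, mul_zero, sub_zero]

theorem eq_smul_of_mem_flag_one {n : ℕ} {b : Module.Basis (Fin (n + 2)) K A} {x : A}
    (hx : x ∈ flag b 1) : x = b.repr x 0 • b 0 := by
  apply b.ext_elem
  intro j
  by_cases hj : j = 0
  · subst hj; simp
  · have h1 : 1 ≤ j.1 := Nat.one_le_iff_ne_zero.2 fun h => hj (Fin.ext h)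
    rw [mem_flag.1 hx j h1]
    simp [Ne.symm hj]

end Flag

/-! ### Flag bases -/

section FlagBasis

variable {K : Type u} {A : Type v} [Field K] [NonUnitalNonAssocRing A] [Module K A]

/-- A basis `u, w, b_2, …, b_(n+1)` with `u ^ 2 = w ^ 2 = 0` and `u w = w u = u`, in which all
other products of distinct basis vectors vanish and the square of each `b_i` lies in the span of
the basis vectors before it. In `E_2(1, -1)` one may take `u = e_1 + e_2` and
`w = (e_1 - e_2) / 2`. -/
structure IsFlagBasis {n : ℕ} (b : Module.Basis (Fin (n + 2)) K A) : Prop where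
  zero_sq : b 0 * b 0 = 0
  one_sq : b 1 * b 1 = 0
  zero_one : b 0 * b 1 = b 0
  one_zero : b 1 * b 0 = b 0
  mul_eq_zero : ∀ i j : Fin (n + 2), i ≠ j → 2 ≤ i.1 ∨ 2 ≤ j.1 → b i * b j = 0
  sq_mem : ∀ i : Fin (n + 2), 2 ≤ i.1 → b i * b i ∈ flag b i.1

/-- A flag basis is regular if the square of each `b_i` with `i ≥ 2` involves `b_(i-1)`. -/
def IsRegular {n : ℕ} (b : Module.Basis (Fin (n + 2)) K A) : Prop :=
  ∀ i j : Fin (n + 2), 2 ≤ i.1 → i.1 = j.1 + 1 → b.repr (b i * b i) j ≠ 0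

variable {n : ℕ} {b : Module.Basis (Fin (n + 2)) K A}
  [IsScalarTower K A A] [SMulCommClass K A A]

namespace IsFlagBasis

/-- The product in coordinates; `j.succ.succ` runs over the indices from `2` on. -/
theorem mul_eq (hb : IsFlagBasis b) (x y : A) :
    x * y = (b.repr x 0 * b.repr y 1 + b.repr x 1 * b.repr y 0) • b 0 +
      ∑ j : Fin n, (b.repr x j.succ.succ * b.repr y j.succ.succ) •
        (b j.succ.succ * b j.succ.succ) := by
  have h2 : ∀ j : Fin n, 2 ≤ (j.succ.succ : Fin (n + 2)).1 := fun j => by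
    simp only [Fin.val_succ]; omega
  have e1 : (1 : Fin (n + 2)) = Fin.succ 0 := rfl
  have ne0 : ∀ j : Fin n, (0 : Fin (n + 2)) ≠ j.succ.succ := fun j => (Fin.succ_ne_zero _).symm
  have ne1 : ∀ j : Fin n, (1 : Fin (n + 2)) ≠ j.succ.succ := fun j => by
    rw [e1]; exact fun h => (Fin.succ_ne_zero _).symm (Fin.succ_injective _ h)
  have l0 : ∀ j : Fin n, b 0 * b j.succ.succ = 0 := fun j =>
    hb.mul_eq_zero _ _ (ne0 j) (.inr (h2 j))
  have l1 : ∀ j : Fin n, b 1 * b j.succ.succ = 0 := fun j =>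
    hb.mul_eq_zero _ _ (ne1 j) (.inr (h2 j))
  have r0 : ∀ j : Fin n, b j.succ.succ * b 0 = 0 := fun j =>
    hb.mul_eq_zero _ _ (ne0 j).symm (.inl (h2 j))
  have r1 : ∀ j : Fin n, b j.succ.succ * b 1 = 0 := fun j =>
    hb.mul_eq_zero _ _ (ne1 j).symm (.inl (h2 j))
  have inner : ∀ j : Fin n, ∑ i : Fin n, b.repr x i.succ.succ •
      (b i.succ.succ * b j.succ.succ) = b.repr x j.succ.succ •
        (b j.succ.succ * b j.succ.succ) := by
    intro j
    refine Finset.sum_eq_single j (fun i _ hi => ?_) (by simp)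
    rw [hb.mul_eq_zero _ _ (fun h => hi ?_) (.inl (h2 i)), smul_zero]
    exact Fin.succ_injective _ (Fin.succ_injective _ h)
  conv_lhs => rw [← b.sum_repr x, ← b.sum_repr y]
  simp only [Finset.sum_mul, Finset.mul_sum, smul_mul_assoc, mul_smul_comm]
  simp only [Fin.sum_univ_succ (n := n + 1), Fin.sum_univ_succ (n := n), ← e1, hb.zero_sq,
    hb.one_sq, hb.zero_one, hb.one_zero, l0, l1, r0, r1, smul_zero, Finset.sum_const_zero,
    add_zero, zero_add, inner]
  simp only [smul_smul, add_smul]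
  rw [← add_assoc, add_comm ((b.repr y 0 * b.repr x 1) • b 0), mul_comm (b.repr y 0),
    mul_comm (b.repr y 1)]
  simp only [mul_comm (b.repr y _)]

theorem repr_mul (hb : IsFlagBasis b) (x y : A) {k : Fin (n + 2)} (hk : 1 ≤ k.1) :
    b.repr (x * y) k = ∑ j : Fin n, (b.repr x j.succ.succ * b.repr y j.succ.succ) *
      b.repr (b j.succ.succ * b j.succ.succ) k := by
  have h0 : (0 : Fin (n + 2)) ≠ k := fun h => by rw [← h] at hk; exact absurd hk (by simp)
  rw [hb.mul_eq x y, map_add, map_smul, map_sum]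
  simp [h0]

theorem mul_comm' (hb : IsFlagBasis b) (x y : A) : x * y = y * x := by
  rw [hb.mul_eq x y, hb.mul_eq y x]
  congr 1
  · congr 1; ring
  · exact Finset.sum_congr rfl fun j _ => by rw [mul_comm (b.repr x _)]

theorem mul_mem_flag (hb : IsFlagBasis b) {i : ℕ} (hi : 1 ≤ i) {x : A} (y : A)
    (hx : x ∈ flag b (i + 1)) : x * y ∈ flag b i := by
  refine mem_flag.2 fun k hk => ?_
  rw [hb.repr_mul x y (hi.trans hk)]
  refine Finset.sum_eq_zero fun j _ => ?_
  by_cases hj : (j.succ.succ : Fin (n + 2)).1 ≤ i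
  · rw [mem_flag.1 (hb.sq_mem j.succ.succ (by simp only [Fin.val_succ]; omega)) k (hj.trans hk),
      mul_zero]
  · rw [mem_flag.1 hx j.succ.succ (by omega), zero_mul, zero_mul]

theorem flag_isIdeal (hb : IsFlagBasis b) {i : ℕ} (hi : 1 ≤ i) : IsIdeal (flag b i) := by
  intro a x hx
  have := hb.mul_mem_flag hi a (flag_mono b (Nat.le_succ i) hx)
  exact ⟨hb.mul_comm' a x ▸ this, this⟩

theorem one_mul_eq (hb : IsFlagBasis b) (x : A) : b 1 * x = b.repr x 0 • b 0 := by
  rw [hb.mul_eq]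
  simp [Fin.ext_iff]

/-- Squaring lowers the top index of a vector by one. -/
theorem repr_sq_ne_zero (hb : IsFlagBasis b) (hr : IsRegular b) {i j : Fin (n + 2)}
    (hi : 2 ≤ i.1) (hij : i.1 = j.1 + 1) {x : A} (hx : x ∈ flag b (i.1 + 1))
    (hxi : b.repr x i ≠ 0) : b.repr (x * x) j ≠ 0 := by
  obtain ⟨i', hi'⟩ : ∃ i' : Fin n, i = i'.succ.succ :=
    ⟨⟨i.1 - 2, by omega⟩, Fin.ext (by simp only [Fin.val_succ]; omega)⟩
  rw [hb.repr_mul x x (by omega), Finset.sum_eq_single i', ← hi']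
  · exact mul_ne_zero (mul_ne_zero hxi hxi) (hr i j hi hij)
  · intro l _ hl
    have hne : (l.succ.succ : Fin (n + 2)).1 ≠ i.1 := fun h => hl
      (Fin.succ_injective _ (Fin.succ_injective _ ((Fin.ext h).trans hi')))
    by_cases hli : (l.succ.succ : Fin (n + 2)).1 < i.1
    · rw [mem_flag.1 (hb.sq_mem l.succ.succ (by simp only [Fin.val_succ]; omega)) j (by omega),
        mul_zero]
    · rw [mem_flag.1 hx l.succ.succ (by omega), zero_mul, zero_mul]
  · simp

/-- In a regular flag basis each term of the flag lies in the square of the next one. -/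
theorem flag_le_prod (hb : IsFlagBasis b) (hr : IsRegular b) {i : ℕ} (hi : i + 1 ≤ n + 2) :
    flag b i ≤ prod (flag b (i + 1)) (flag b (i + 1)) := by
  have key : ∀ k : ℕ, k ≤ i → flag b k ≤ prod (flag b (i + 1)) (flag b (i + 1)) := by
    intro k
    induction k with
    | zero => intro _; rw [flag_zero]; exact bot_le
    | succ k ih =>
      intro hk
      rw [flag, Submodule.span_le]
      rintro _ ⟨j, hj, rfl⟩
      have hj : j.1 < k + 1 := hj
      by_cases h0 : j.1 = 0
      · have hj0 : j = 0 := Fin.ext h0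
        rw [hj0, ← hb.zero_one]
        exact mul_mem_prod (basis_mem_flag (by simp))
          (basis_mem_flag (by simp only [Fin.val_one]; omega))
      · have hs : j.1 + 1 < n + 2 := by omega
        have hc := hr ⟨j.1 + 1, hs⟩ j (by simp only; omega) rfl
        have hsq := hb.sq_mem ⟨j.1 + 1, hs⟩ (by simp only; omega)
        set z := b ⟨j.1 + 1, hs⟩ * b ⟨j.1 + 1, hs⟩ with hz
        have hzP : z ∈ prod (flag b (i + 1)) (flag b (i + 1)) :=
          mul_mem_prod (basis_mem_flag (by simp only; omega))
            (basis_mem_flag (by simp only; omega))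
        have h1 := sub_smul_mem_flag b hsq hc (basis_mem_flag (Nat.lt_succ_self j.1))
        have h2 := flag_mono b (by omega : j.1 ≤ k) h1
        have h3 := add_mem (ih (by omega) h2)
          (Submodule.smul_mem _ (b.repr (b j) j / b.repr z j) hzP)
        rwa [sub_add_cancel] at h3
  exact key i le_rfl

theorem hasMaxSolvIndex (hb : IsFlagBasis b) (hr : IsRegular b) (hE : IsEvolution K A)
    (hA : IsSolv K A) : HasMaxSolvIndex K A := by
  have hf : Module.finrank K A = n + 2 := by
    rw [Module.finrank_eq_card_basis b, Fintype.card_fin]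
  refine hasMaxSolvIndex_of_lt hE hA (by omega) ?_
  rw [hf]
  refine lt_solvIndex_of_filtration hA (V := flag b) (fun i => hb.flag_le_prod hr) (by omega) ?_
  intro h
  have : b 0 ∈ flag b 1 := basis_mem_flag (by simp)
  rw [h, Submodule.mem_bot] at this
  exact b.ne_zero 0 this

/-- If the square of some `b_i`, `i ≥ 2`, did not involve `b_(i-1)`, then `A ^ 2` would be spanned
by the `b_j` with `j < i - 1` and the `b_j ^ 2` with `j > i`. -/
theorem isRegular_of_finrank_le (hb : IsFlagBasis b)
    (h : n + 2 ≤ Module.finrank K (prod (⊤ : Submodule K A) ⊤) + 1) : IsRegular b := by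
  classical
  intro i j hi hij hzero
  let g : Fin (n + 2) → A := fun l => if l.1 < i.1 then b l else b l * b l
  let S : Finset A := ((Finset.univ.erase i).erase j).image g
  have hS : S.card ≤ n := by
    refine Finset.card_image_le.trans (le_of_eq ?_)
    have hji : j ≠ i := fun h => by rw [h] at hij; omega
    rw [Finset.card_erase_of_mem (by simp [hji]), Finset.card_erase_of_mem (by simp),
      Finset.card_univ, Fintype.card_fin]
    omega
  have hflag : flag b j.1 ≤ Submodule.span K (S : Set A) := by
    rw [flag, Submodule.span_le]
    rintro _ ⟨l, hl, rfl⟩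
    have hl : l.1 < j.1 := hl
    refine Submodule.subset_span (Finset.mem_coe.2 (Finset.mem_image.2 ⟨l, ?_, ?_⟩))
    · simp [Fin.ext_iff]; omega
    · simp only [g]; rw [if_pos (by omega)]
  have hsq : ∀ l : Fin (n + 2), 2 ≤ l.1 → b l * b l ∈ Submodule.span K (S : Set A) := by
    intro l hl
    rcases lt_trichotomy l.1 i.1 with h1 | h1 | h1
    · exact hflag (flag_mono b (by omega) (hb.sq_mem l hl))
    · have hli : l = i := Fin.ext h1
      subst hli
      refine hflag (mem_flag.2 fun k hk => ?_)
      rcases Nat.eq_or_lt_of_le hk with h2 | h2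
      · rw [← Fin.ext h2]; exact hzero
      · exact mem_flag.1 (hb.sq_mem l hl) k (by omega)
    · refine Submodule.subset_span (Finset.mem_coe.2 (Finset.mem_image.2 ⟨l, ?_, ?_⟩))
      · simp [Fin.ext_iff]; omega
      · simp only [g]; rw [if_neg (by omega)]
  have hle : prod (⊤ : Submodule K A) ⊤ ≤ Submodule.span K (S : Set A) := by
    refine prod_le.2 fun x _ y _ => ?_
    rw [hb.mul_eq x y]
    refine add_mem (Submodule.smul_mem _ _ (hflag (basis_mem_flag ?_)))
      (Submodule.sum_mem _ fun l _ => Submodule.smul_mem _ _ (hsq _ ?_))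
    · simp only [Fin.val_zero]; omega
    · simp only [Fin.val_succ]; omega
  have := Submodule.finrank_mono (R := K) hle
  have : Module.finrank K (Submodule.span K (S : Set A)) ≤ S.card :=
    finrank_span_finset_le_card S
  omega

end IsFlagBasis

end FlagBasis

/-! ### The subalgebra lattice of a regular flag basis -/

section Lattice

variable {K : Type u} {A : Type v} [Field K] [NonUnitalNonAssocRing A] [Module K A]

/-- A subspace closed under multiplication, as a subalgebra. -/
def subalgebraOfMul (S : Submodule K A) (h : ∀ x ∈ S, ∀ y ∈ S, x * y ∈ S) :
    NonUnitalSubalgebra K A :=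
  { S with mul_mem' := fun hx hy => h _ hx _ hy }

theorem mem_subalgebraOfMul {S : Submodule K A} {h : ∀ x ∈ S, ∀ y ∈ S, x * y ∈ S} {x : A} :
    x ∈ subalgebraOfMul S h ↔ x ∈ S := Iff.rfl

variable [IsScalarTower K A A] [SMulCommClass K A A]

theorem IsDistributive.isModular (h : IsDistributive K A) : IsModular K A := by
  intro U V W hUW
  rw [h U V W, sup_eq_right.2 hUW]

theorem IsModular.isUpperSemimodular (h : IsModular K A) : IsUpperSemimodular K A := by
  have : IsModularLattice (NonUnitalSubalgebra K A) :=
    ⟨fun {x} y {z} hxz => (h x y z hxz).ge⟩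
  exact fun U V hUV => covBy_sup_of_inf_covBy_right hUV

namespace IsFlagBasis

variable {n : ℕ} {b : Module.Basis (Fin (n + 2)) K A}

/-- A subalgebra containing a vector with top index `i ≥ 1` contains one with top index `1`. -/
theorem exists_top_one (hb : IsFlagBasis b) (hr : IsRegular b) (U : NonUnitalSubalgebra K A)
    {i : Fin (n + 2)} (hi : 1 ≤ i.1) {x : A} (hxU : x ∈ U) (hx : x ∈ flag b (i.1 + 1))
    (hxi : b.repr x i ≠ 0) : ∃ y ∈ U, y ∈ flag b 2 ∧ b.repr y 1 ≠ 0 := by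
  obtain ⟨k, hk⟩ := Nat.exists_eq_add_of_le' hi
  induction k generalizing i x with
  | zero =>
    have h1 : i = 1 := Fin.ext hk
    subst h1
    exact ⟨x, hxU, hx, hxi⟩
  | succ k ih =>
    have hlt : k + 1 < n + 2 := by omega
    refine ih (i := ⟨k + 1, hlt⟩) (by simp only; omega) (U.mul_mem hxU hxU) ?_
      (hb.repr_sq_ne_zero hr (by omega) hk hx hxi) rfl
    exact hb.mul_mem_flag (by omega) x (by rw [hk] at hx; exact hx)

/-- A subalgebra either contains `u` or lies in the hyperplane spanned by the other vectors of the
basis. -/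
theorem zero_mem_or (hchar : (2 : K) ≠ 0) (hb : IsFlagBasis b) (hr : IsRegular b)
    (U : NonUnitalSubalgebra K A) : b 0 ∈ U ∨ ∀ x ∈ U, b.repr x 0 = 0 := by
  by_contra! hcon
  obtain ⟨hu, x, hxU, hx0⟩ := hcon
  -- the coordinate of `w x` at `u` is that of `x`, so `w` is not in `U`
  have hw : b 1 ∉ U := fun hw => hu <| by
    have h := U.smul_mem (b.repr x 0)⁻¹ (U.mul_mem hw hxU)
    rwa [hb.one_mul_eq, smul_smul, inv_mul_cancel₀ hx0, one_smul] at h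
  obtain ⟨i, hxi, hx⟩ := exists_top_coord b (x := x) (fun h => hx0 (by simp [h]))
  have hi : 1 ≤ i.1 := by
    by_contra hlt
    have hi0 : i.1 = 0 := by omega
    rw [hi0, zero_add] at hx
    have h := U.smul_mem (b.repr x 0)⁻¹ hxU
    rw [eq_smul_of_mem_flag_one hx, smul_smul] at h
    simp [hx0] at h
    exact hu h
  obtain ⟨y, hyU, hy, hy1⟩ := hb.exists_top_one hr U hi hxU hx hxi
  -- `y = α u + β w` with `β ≠ 0`, and `y ^ 2 = 2 α β u`
  have hsq : y * y = (2 * b.repr y 0 * b.repr y 1) • b 0 := by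
    have h0 : ∀ j : Fin n, b.repr y j.succ.succ = 0 := fun j =>
      mem_flag.1 hy _ (by simp only [Fin.val_succ]; omega)
    rw [hb.mul_eq]
    simp only [h0, zero_mul, zero_smul, Finset.sum_const_zero, add_zero]
    congr 1; ring
  by_cases hy0 : b.repr y 0 = 0
  · refine hw ?_
    have hyw : y = b.repr y 1 • b 1 := by
      have h := sub_smul_mem_flag b (i := (1 : Fin (n + 2))) hy hy1
        (basis_mem_flag (j := (1 : Fin (n + 2))) (by simp))
      have h' := eq_smul_of_mem_flag_one (x := b 1 - (b.repr (b 1) 1 / b.repr y 1) • y)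
        (by simpa using h)
      simp [hy0] at h'
      rw [sub_eq_zero] at h'
      rw [h', smul_smul, mul_inv_cancel₀ hy1, one_smul]
    have h := U.smul_mem (b.repr y 1)⁻¹ hyU
    rw [hyw] at h
    simpa [smul_smul, hy1] using h
  · have hne : 2 * b.repr y 0 * b.repr y 1 ≠ 0 := mul_ne_zero (mul_ne_zero hchar hy0) hy1
    have h := U.smul_mem (2 * b.repr y 0 * b.repr y 1)⁻¹ (U.mul_mem hyU hyU)
    rw [hsq, smul_smul, inv_mul_cancel₀ hne, one_smul] at h
    exact hu h

/-- Up to the coordinate at `u`, a subalgebra contains every vector whose top index does not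
exceed the top index of one of its elements. -/
theorem mem_of_top (hchar : (2 : K) ≠ 0) (hb : IsFlagBasis b) (hr : IsRegular b)
    (U : NonUnitalSubalgebra K A) {i : Fin (n + 2)} {x y : A} (hxU : x ∈ U)
    (hx : x ∈ flag b (i.1 + 1)) (hxi : b.repr x i ≠ 0) (hy : y ∈ flag b (i.1 + 1))
    (h0 : b 0 ∈ U ∨ b.repr y 0 = 0) : y ∈ U := by
  obtain ⟨k, hk⟩ : ∃ k, i.1 = k := ⟨_, rfl⟩
  induction k generalizing i x y with
  | zero =>
    rw [hk, zero_add] at hy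
    rw [eq_smul_of_mem_flag_one hy]
    rcases h0 with h0 | h0
    · exact U.smul_mem _ h0
    · rw [h0, zero_smul]; exact U.zero_mem
  | succ k ih =>
    suffices h : y - (b.repr y i / b.repr x i) • x ∈ U by
      have := U.add_mem h (U.smul_mem (b.repr y i / b.repr x i) hxU)
      rwa [sub_add_cancel] at this
    have hlow := sub_smul_mem_flag b hx hxi hy
    have h0' : b 0 ∈ U ∨ b.repr (y - (b.repr y i / b.repr x i) • x) 0 = 0 := by
      rcases hb.zero_mem_or hchar hr U with hu | hU
      · exact .inl hu
      · refine h0.imp_right fun hy0 => ?_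
        rw [map_sub, map_smul, Finsupp.sub_apply, Finsupp.smul_apply, hy0, hU x hxU]
        simp
    rcases Nat.eq_zero_or_pos k with rfl | hkpos
    · rw [hk, zero_add] at hlow
      rw [eq_smul_of_mem_flag_one hlow]
      rcases h0' with h0' | h0'
      · exact U.smul_mem _ h0'
      · rw [h0', zero_smul]; exact U.zero_mem
    · have hlt : k < n + 2 := by omega
      refine ih (i := ⟨k, hlt⟩) (U.mul_mem hxU hxU) ?_
        (hb.repr_sq_ne_zero hr (by omega) hk hx hxi) (by rw [hk] at hlow; exact hlow) h0' rfl
      exact hb.mul_mem_flag (by omega) x (by rw [hk] at hx; exact hx)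

/-- The intersections of the subalgebras with the hyperplane spanned by the basis vectors other
than `u` form a chain. -/
theorem hyperplane_total (hchar : (2 : K) ≠ 0) (hb : IsFlagBasis b) (hr : IsRegular b)
    (U V : NonUnitalSubalgebra K A) :
    (∀ x, b.repr x 0 = 0 → x ∈ U → x ∈ V) ∨ (∀ x, b.repr x 0 = 0 → x ∈ V → x ∈ U) := by
  by_contra! hcon
  obtain ⟨⟨x, hx0, hxU, hxV⟩, y, hy0, hyV, hyU⟩ := hcon
  obtain ⟨i, hxi, hx⟩ := exists_top_coord b (x := x) (fun h => hxV (h ▸ V.zero_mem))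
  obtain ⟨j, hyj, hy⟩ := exists_top_coord b (x := y) (fun h => hyU (h ▸ U.zero_mem))
  rcases Nat.le_total i.1 j.1 with hij | hij
  · exact hxV (hb.mem_of_top hchar hr V hyV hy hyj (flag_mono b (by omega) hx) (.inr hx0))
  · exact hyU (hb.mem_of_top hchar hr U hxU hx hxi (flag_mono b (by omega) hy) (.inr hy0))

/-- Membership in a subalgebra splits along `A = K u ⊕ H`, where `H` is the hyperplane of vectors
without coordinate at `u`. -/
theorem mem_iff (hchar : (2 : K) ≠ 0) (hb : IsFlagBasis b) (hr : IsRegular b)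
    (U : NonUnitalSubalgebra K A) (x : A) :
    x ∈ U ↔ (b 0 ∈ U ∨ b.repr x 0 = 0) ∧ x - b.repr x 0 • b 0 ∈ U := by
  constructor
  · intro hx
    rcases hb.zero_mem_or hchar hr U with hu | hU
    · exact ⟨.inl hu, U.sub_mem hx (U.smul_mem _ hu)⟩
    · rw [hU x hx, zero_smul, sub_zero]
      exact ⟨.inr rfl, hx⟩
  · rintro ⟨hu | h0, h⟩
    · have := U.add_mem h (U.smul_mem (b.repr x 0) hu)
      rwa [sub_add_cancel] at this
    · rwa [h0, zero_smul, sub_zero] at h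

theorem le_of_hyperplane (hchar : (2 : K) ≠ 0) (hb : IsFlagBasis b) (hr : IsRegular b)
    {U V : NonUnitalSubalgebra K A} (h : ∀ x, b.repr x 0 = 0 → x ∈ U → x ∈ V)
    (hu : b 0 ∈ U → b 0 ∈ V) : U ≤ V := by
  intro x hx
  rw [hb.mem_iff hchar hr U x] at hx
  rw [hb.mem_iff hchar hr V x]
  exact ⟨hx.1.imp_left hu, h _ (by simp) hx.2⟩

theorem mem_sup_iff_of_le (hchar : (2 : K) ≠ 0) (hb : IsFlagBasis b) (hr : IsRegular b)
    {U V : NonUnitalSubalgebra K A} (h : ∀ x, b.repr x 0 = 0 → x ∈ U → x ∈ V) (x : A) :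
    x ∈ U ⊔ V ↔ (b 0 ∈ U ∨ b 0 ∈ V ∨ b.repr x 0 = 0) ∧ x - b.repr x 0 • b 0 ∈ V := by
  by_cases huV : b 0 ∈ U → b 0 ∈ V
  · rw [sup_eq_right.2 (hb.le_of_hyperplane hchar hr h huV), hb.mem_iff hchar hr V x]
    tauto
  · rw [Classical.not_imp] at huV
    -- `V + K u` is a subalgebra, as `K u` is an ideal
    let X : NonUnitalSubalgebra K A := subalgebraOfMul (V.toSubmodule ⊔ flag b 1) <| by
      intro x hx y hy
      obtain ⟨x₁, hx₁, x₂, hx₂, rfl⟩ := Submodule.mem_sup.1 hx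
      obtain ⟨y₁, hy₁, y₂, hy₂, rfl⟩ := Submodule.mem_sup.1 hy
      rw [add_mul, mul_add, add_assoc]
      exact add_mem (Submodule.mem_sup_left (V.mul_mem hx₁ hy₁))
        (Submodule.mem_sup_right (add_mem (hb.flag_isIdeal le_rfl _ _ hy₂).1
          (hb.flag_isIdeal le_rfl _ _ hx₂).2))
    constructor
    · intro hx
      refine ⟨.inl huV.1, ?_⟩
      have hXle : U ⊔ V ≤ X := by
        refine sup_le (hb.le_of_hyperplane hchar hr (fun x h0 hx => ?_) fun _ => ?_) fun x hx => ?_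
        · exact Submodule.mem_sup_left (h x h0 hx)
        · exact Submodule.mem_sup_right (basis_mem_flag (by simp))
        · exact Submodule.mem_sup_left hx
      obtain ⟨x₁, hx₁, x₂, hx₂, rfl⟩ := Submodule.mem_sup.1 (hXle hx)
      have h1 := (hb.zero_mem_or hchar hr V).resolve_left huV.2 x₁ hx₁
      have h2 := eq_smul_of_mem_flag_one hx₂
      rw [map_add, Finsupp.add_apply, h1, zero_add, ← h2, add_sub_cancel_right]
      exact hx₁
    · rintro ⟨-, hx⟩
      have hV : V ≤ U ⊔ V := le_sup_right
      have hU : U ≤ U ⊔ V := le_sup_left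
      have := (U ⊔ V).add_mem (hV hx) ((U ⊔ V).smul_mem (b.repr x 0) (hU huV.1))
      rwa [sub_add_cancel] at this

/-- The splitting of `mem_iff` is compatible with joins. -/
theorem mem_sup_iff (hchar : (2 : K) ≠ 0) (hb : IsFlagBasis b) (hr : IsRegular b)
    (U V : NonUnitalSubalgebra K A) (x : A) :
    x ∈ U ⊔ V ↔ (b 0 ∈ U ∨ b 0 ∈ V ∨ b.repr x 0 = 0) ∧
      (x - b.repr x 0 • b 0 ∈ U ∨ x - b.repr x 0 • b 0 ∈ V) := by
  have h0 : b.repr (x - b.repr x 0 • b 0) 0 = 0 := by simp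
  rcases hb.hyperplane_total hchar hr U V with h | h
  · rw [hb.mem_sup_iff_of_le hchar hr h x]
    have := h _ h0
    tauto
  · rw [sup_comm, hb.mem_sup_iff_of_le hchar hr h x]
    have := h _ h0
    tauto

/-- The subalgebra lattice embeds in the product of a two-element chain (does `U` contain `u`?)
and the chain of the intersections with a hyperplane. -/
theorem isDistributive (hchar : (2 : K) ≠ 0) (hb : IsFlagBasis b) (hr : IsRegular b) :
    IsDistributive K A := by
  intro U V W
  ext x
  rw [NonUnitalAlgebra.mem_inf, hb.mem_sup_iff hchar hr, hb.mem_sup_iff hchar hr,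
    hb.mem_sup_iff hchar hr, NonUnitalAlgebra.mem_inf, NonUnitalAlgebra.mem_inf]
  tauto

end IsFlagBasis

/-! ### Pentagons -/

/-- Modulo the ideal `J`, the subalgebras `K p`, `K q` and `K p + K a` generate a pentagon when
`p ^ 2 = q ^ 2 = a ^ 2 = 0`, `p q` is a nonzero multiple of `a`, and `p a`, `a p` lie in `K a`. -/
theorem not_isModular_of_pentagon {J : Submodule K A} (hJ : IsIdeal J) {p q a : A} {c : K}
    (hp : p * p ∈ J) (hq : q * q ∈ J) (ha : a * a ∈ J)
    (hpa : ∃ s : K, p * a - s • a ∈ J) (hap : ∃ s : K, a * p - s • a ∈ J)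
    (hpq : p * q - c • a ∈ J) (hc : c ≠ 0)
    (hind : ∀ α β γ : K, α • p + β • q + γ • a ∈ J → α = 0 ∧ β = 0 ∧ γ = 0) :
    ¬ IsModular K A := by
  intro hmod
  have hline : ∀ z : A, z * z ∈ J → ∀ x ∈ J ⊔ Submodule.span K {z},
      ∀ y ∈ J ⊔ Submodule.span K {z}, x * y ∈ J ⊔ Submodule.span K {z} := by
    intro z hz x hx y hy
    obtain ⟨x₁, hx₁, x₂, hx₂, rfl⟩ := Submodule.mem_sup.1 hx
    obtain ⟨y₁, hy₁, y₂, hy₂, rfl⟩ := Submodule.mem_sup.1 hy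
    obtain ⟨s, rfl⟩ := Submodule.mem_span_singleton.1 hx₂
    obtain ⟨t, rfl⟩ := Submodule.mem_span_singleton.1 hy₂
    refine Submodule.mem_sup_left ?_
    rw [add_mul]
    refine J.add_mem (hJ _ _ hx₁).2 ?_
    rw [mul_add]
    refine J.add_mem (hJ _ _ hy₁).1 ?_
    rw [smul_mul_assoc, mul_smul_comm]
    exact J.smul_mem _ (J.smul_mem _ hz)
  have haJ : ∀ z ∈ J ⊔ Submodule.span K {a},
      z ∈ J ⊔ (Submodule.span K {p} ⊔ Submodule.span K {a}) :=
    fun z hz =>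
    (sup_le_sup le_rfl le_sup_right : J ⊔ Submodule.span K {a} ≤ _) hz
  have hres : ∀ z : A, (∃ s : K, z - s • a ∈ J) →
      z ∈ J ⊔ (Submodule.span K {p} ⊔ Submodule.span K {a}) := by
    rintro z ⟨s, hs⟩
    refine haJ z ?_
    rw [← sub_add_cancel z (s • a)]
    exact Submodule.add_mem_sup hs (Submodule.smul_mem _ _ (Submodule.mem_span_singleton_self a))
  have hplane : ∀ x ∈ J ⊔ (Submodule.span K {p} ⊔ Submodule.span K {a}),
      ∀ y ∈ J ⊔ (Submodule.span K {p} ⊔ Submodule.span K {a}),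
      x * y ∈ J ⊔ (Submodule.span K {p} ⊔ Submodule.span K {a}) := by
    intro x hx y hy
    obtain ⟨x₁, hx₁, x₂, hx₂, rfl⟩ := Submodule.mem_sup.1 hx
    obtain ⟨y₁, hy₁, y₂, hy₂, rfl⟩ := Submodule.mem_sup.1 hy
    obtain ⟨x₃, hx₃, x₄, hx₄, rfl⟩ := Submodule.mem_sup.1 hx₂
    obtain ⟨y₃, hy₃, y₄, hy₄, rfl⟩ := Submodule.mem_sup.1 hy₂
    obtain ⟨s, rfl⟩ := Submodule.mem_span_singleton.1 hx₃
    obtain ⟨t, rfl⟩ := Submodule.mem_span_singleton.1 hy₃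
    obtain ⟨s', rfl⟩ := Submodule.mem_span_singleton.1 hx₄
    obtain ⟨t', rfl⟩ := Submodule.mem_span_singleton.1 hy₄
    rw [add_mul]
    refine add_mem (Submodule.mem_sup_left (hJ _ _ hx₁).2) ?_
    rw [mul_add]
    refine add_mem (Submodule.mem_sup_left (hJ _ _ hy₁).1) ?_
    simp only [add_mul, mul_add, smul_mul_assoc, mul_smul_comm, smul_add]
    refine add_mem (add_mem ?_ ?_) (add_mem ?_ ?_)
    · exact Submodule.smul_mem _ _ (Submodule.smul_mem _ _ (Submodule.mem_sup_left hp))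
    · exact Submodule.smul_mem _ _ (Submodule.smul_mem _ _ (hres _ hap))
    · exact Submodule.smul_mem _ _ (Submodule.smul_mem _ _ (hres _ hpa))
    · exact Submodule.smul_mem _ _ (Submodule.smul_mem _ _ (Submodule.mem_sup_left ha))
  let U := subalgebraOfMul _ (hline p hp)
  let V := subalgebraOfMul _ (hline q hq)
  let W := subalgebraOfMul _ hplane
  have hUW : U ≤ W := fun x hx =>
    (sup_le_sup le_rfl le_sup_left : J ⊔ Submodule.span K {p} ≤ _) hx
  have hVW : V ⊓ W ≤ U := by
    rintro x ⟨hxV, hxW⟩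
    obtain ⟨x₁, hx₁, x₂, hx₂, rfl⟩ := Submodule.mem_sup.1 (mem_subalgebraOfMul.1 hxV)
    obtain ⟨s, rfl⟩ := Submodule.mem_span_singleton.1 hx₂
    obtain ⟨y₁, hy₁, y₂, hy₂, hxy⟩ := Submodule.mem_sup.1 (mem_subalgebraOfMul.1 hxW)
    obtain ⟨y₃, hy₃, y₄, hy₄, rfl⟩ := Submodule.mem_sup.1 hy₂
    obtain ⟨t, rfl⟩ := Submodule.mem_span_singleton.1 hy₃
    obtain ⟨t', rfl⟩ := Submodule.mem_span_singleton.1 hy₄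
    have h : t • p + (-s) • q + t' • a ∈ J := by
      have e : t • p + (-s) • q + t' • a = x₁ - y₁ := by
        rw [neg_smul, ← sub_eq_zero]
        have := sub_eq_zero.2 hxy
        rw [← this]; abel
      rw [e]; exact J.sub_mem hx₁ hy₁
    have hs : s = 0 := neg_eq_zero.1 (hind _ _ _ h).2.1
    rw [hs, zero_smul, add_zero]
    exact mem_subalgebraOfMul.2 (Submodule.mem_sup_left hx₁)
  have hpU : p ∈ U := mem_subalgebraOfMul.2 (Submodule.mem_sup_right
    (Submodule.mem_span_singleton_self p))
  have hqV : q ∈ V := mem_subalgebraOfMul.2 (Submodule.mem_sup_right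
    (Submodule.mem_span_singleton_self q))
  have hJU : ∀ x ∈ J, x ∈ U := fun x hx => mem_subalgebraOfMul.2 (Submodule.mem_sup_left hx)
  have hU : U ≤ U ⊔ V := le_sup_left
  have hV : V ≤ U ⊔ V := le_sup_right
  have haUV : a ∈ U ⊔ V := by
    have h := (U ⊔ V).smul_mem c⁻¹ ((U ⊔ V).sub_mem ((U ⊔ V).mul_mem (hU hpU) (hV hqV))
      (hU (hJU _ hpq)))
    rwa [sub_sub_cancel, smul_smul, inv_mul_cancel₀ hc, one_smul] at h
  have haW : a ∈ W := mem_subalgebraOfMul.2 (Submodule.mem_sup_right (Submodule.mem_sup_right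
    (Submodule.mem_span_singleton_self a)))
  have haU : a ∈ U := by
    have h : a ∈ (U ⊔ V) ⊓ W := ⟨haUV, haW⟩
    rwa [← hmod U V W hUW, sup_eq_left.2 hVW] at h
  obtain ⟨x₁, hx₁, x₂, hx₂, hx⟩ := Submodule.mem_sup.1 (mem_subalgebraOfMul.1 haU)
  obtain ⟨s, rfl⟩ := Submodule.mem_span_singleton.1 hx₂
  have h : (-s) • p + (0 : K) • q + (1 : K) • a ∈ J := by
    rw [← hx]
    have e : (-s) • p + (0 : K) • q + (1 : K) • (x₁ + s • p) = x₁ := by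
      rw [zero_smul, one_smul, neg_smul]; abel
    rwa [e]
  exact one_ne_zero (hind _ _ _ h).2.2

/-- If `u ^ 2 = w ^ 2 = 0` and `u w = w u = u`, every further vector `z` that acts on `u` and `w`
by multiples of `u`, and whose square is a multiple of `u`, obstructs modularity. -/
theorem not_isModular_of_hyperbolic (hchar : (2 : K) ≠ 0) {u w z : A} {s t c : K}
    (huu : u * u = 0) (hww : w * w = 0) (huw : u * w = u) (hwu : w * u = u)
    (huz : u * z = s • u) (hzu : z * u = s • u) (hwz : w * z = t • u) (hzw : z * w = t • u)
    (hzz : z * z = c • u)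
    (hind : ∀ α β γ : K, α • u + β • w + γ • z = 0 → α = 0 ∧ β = 0 ∧ γ = 0) :
    ¬ IsModular K A := by
  -- `y` annihilates `u` and `w`
  obtain ⟨y, hy⟩ : ∃ y, y = z - t • u - s • w := ⟨_, rfl⟩
  -- `d` is half the coefficient of `u` in `y ^ 2`, so that `u - d w + y` has square zero
  obtain ⟨d, hd⟩ : ∃ d : K, d = (c - 2 * s * t) / 2 := ⟨_, rfl⟩
  have huy : u * y = 0 := by simp [hy, mul_sub, mul_smul_comm, huu, huw, huz]
  have hyu : y * u = 0 := by simp [hy, sub_mul, smul_mul_assoc, huu, hwu, hzu]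
  have hwy : w * y = 0 := by simp [hy, mul_sub, mul_smul_comm, hww, hwu, hwz]
  have hyw : y * w = 0 := by simp [hy, sub_mul, smul_mul_assoc, hww, huw, hzw]
  have hyy : y * y = (2 * d) • u := by
    have h1 : y * y = y * z := by
      conv_lhs => rw [congrArg (y * ·) hy]
      simp [mul_sub, mul_smul_comm, hyu, hyw]
    rw [h1, hy, sub_mul, sub_mul, smul_mul_assoc, smul_mul_assoc, hzz, huz, hwz, smul_smul,
      smul_smul, ← sub_smul, ← sub_smul, hd]
    congr 1; field_simp; ring
  refine not_isModular_of_pentagon (J := ⊥) (fun a x hx => by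
    simp [(Submodule.mem_bot K).1 hx]) (p := w) (q := u - d • w + y) (a := u)
    (c := 1) ?_ ?_ ?_ ⟨1, ?_⟩ ⟨1, ?_⟩ ?_ one_ne_zero ?_
  · simp [hww]
  · simp only [add_mul, mul_add, sub_mul, mul_sub, smul_mul_assoc, mul_smul_comm, huu, hww, huw,
      hwu, huy, hyu, hwy, hyw, hyy, smul_zero, Submodule.mem_bot]
    module
  · simp [huu]
  · simp [hwu]
  · simp [huw]
  · simp [mul_add, mul_sub, mul_smul_comm, hwu, hww, hwy]
  · intro α β γ h
    rw [Submodule.mem_bot, hy] at h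
    have h' : (β + γ - β * t) • u + (α - β * d - β * s) • w + β • z = 0 := by
      rw [← h]; module
    obtain ⟨h1, h2, h3⟩ := hind _ _ _ h'
    subst h3
    simp only [zero_mul, sub_zero, zero_add] at h1 h2
    exact ⟨h2, rfl, h1⟩

namespace IsFlagBasis

variable {n : ℕ} {b : Module.Basis (Fin (n + 2)) K A}

/-- At the least `i` for which `b_i ^ 2` does not involve `b_(i-1)`, either `b_i ^ 2` lies in `K u`
and `b_i` is a vector as in `not_isModular_of_hyperbolic`, or `b_i ^ 2` has the same top index `k`
as `b_(k+1) ^ 2`, and there is a pentagon modulo the span of the `b_j` with `j < k`. -/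
theorem isRegular_of_isModular (hchar : (2 : K) ≠ 0) (hquad : ∀ a : K, IsSquare a)
    (hb : IsFlagBasis b) (hmod : IsModular K A) : IsRegular b := by
  intro i
  induction i using WellFoundedLT.induction with
  | _ i ih =>
  intro j hi hij hzero
  have hlow : b i * b i ∈ flag b j.1 := by
    refine mem_flag.2 fun k hk => ?_
    rcases Nat.eq_or_lt_of_le hk with h | h
    · rw [← Fin.ext h]; exact hzero
    · exact mem_flag.1 (hb.sq_mem i hi) k (by omega)
  by_cases h1 : b i * b i ∈ flag b 1
  · have hi0 : i ≠ 0 := fun h => by rw [h] at hi; simp at hi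
    have hi1 : i ≠ 1 := fun h => by rw [h] at hi; simp at hi
    refine not_isModular_of_hyperbolic hchar (z := b i) (s := 0) (t := 0) hb.zero_sq hb.one_sq
      hb.zero_one hb.one_zero ?_ ?_ ?_ ?_ (eq_smul_of_mem_flag_one h1) ?_ hmod
    · rw [hb.mul_eq_zero _ _ hi0.symm (.inr hi), zero_smul]
    · rw [hb.mul_eq_zero _ _ hi0 (.inl hi), zero_smul]
    · rw [hb.mul_eq_zero _ _ hi1.symm (.inr hi), zero_smul]
    · rw [hb.mul_eq_zero _ _ hi1 (.inl hi), zero_smul]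
    · intro α β γ h
      have e := fun k => congrArg (fun x => b.repr x k) h
      have e0 := e 0
      have e1 := e 1
      have ei := e i
      simp [hi0, hi1, hi0.symm, hi1.symm] at e0 e1 ei
      exact ⟨e0, e1, ei⟩
  · obtain ⟨k, hk, hik⟩ := exists_top_coord b (x := b i * b i)
      (fun h => h1 (h ▸ zero_mem _))
    have hk1 : 1 ≤ k.1 := by
      by_contra hlt
      exact h1 (flag_mono b (by omega) hik)
    have hkj : k.1 < j.1 := by
      by_contra hlt
      exact hk (mem_flag.1 hlow k (by omega))
    -- the squares of `b_l` and `b_i` have the same top index `k`, so that modulo `flag b k` the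
    -- vectors `b_i ± t b_l` have square zero for a suitable `t`
    obtain ⟨l, hl⟩ : ∃ l : Fin (n + 2), l.1 = k.1 + 1 := ⟨⟨k.1 + 1, by omega⟩, rfl⟩
    have hli : l ≠ i := fun h => by rw [h] at hl; omega
    have hkl : k ≠ l := fun h => by rw [← h] at hl; omega
    have hki : k ≠ i := fun h => by rw [h] at hkj; omega
    have hlreg := ih l (by rw [Fin.lt_def]; omega) k (by omega) hl
    have hlsq := hb.sq_mem l (by omega)
    rw [hl] at hlsq
    have hmod_k : ∀ x ∈ flag b (k.1 + 1), x - b.repr x k • b k ∈ flag b k.1 := by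
      intro x hx
      have := sub_smul_mem_flag b (basis_mem_flag (Nat.lt_succ_self k.1)) (by simp) hx
      simpa using this
    obtain ⟨α, hα⟩ : ∃ α, α = b.repr (b l * b l) k := ⟨_, rfl⟩
    obtain ⟨β, hβ⟩ : ∃ β, β = b.repr (b i * b i) k := ⟨_, rfl⟩
    have hx := hmod_k _ hlsq
    have hy := hmod_k _ hik
    rw [← hα] at hx hlreg
    rw [← hβ] at hy hk
    obtain ⟨t, ht⟩ := hquad (-β / α)
    have ht0 : t ≠ 0 := by
      rintro rfl
      rw [mul_zero, div_eq_zero_iff] at ht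
      exact ht.elim (fun h => hk (neg_eq_zero.1 h)) hlreg
    have htα : t * t * α = -β := by rw [← ht]; field_simp
    have hil : b i * b l = 0 := hb.mul_eq_zero _ _ hli.symm (.inl hi)
    have hlk : b l * b k = 0 := hb.mul_eq_zero _ _ hkl.symm (.inl (by omega))
    have hkl' : b k * b l = 0 := hb.mul_eq_zero _ _ hkl (.inr (by omega))
    have hli' : b l * b i = 0 := hb.mul_eq_zero _ _ hli (.inr hi)
    have hik' : b i * b k = 0 := hb.mul_eq_zero _ _ hki.symm (.inl hi)
    have hki' : b k * b i = 0 := hb.mul_eq_zero _ _ hki (.inr hi)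
    have hnull : b i * b i + (t * t) • (b l * b l) ∈ flag b k.1 := by
      have h := add_mem hy (Submodule.smul_mem _ (t * t) hx)
      have e : b i * b i + (t * t) • (b l * b l) = b i * b i - β • b k +
          (t * t) • (b l * b l - α • b k) := by
        rw [smul_sub, smul_smul, htα]; module
      rwa [e]
    refine not_isModular_of_pentagon (J := flag b k.1) (hb.flag_isIdeal hk1) (p := b i + t • b l)
      (q := b i - t • b l) (a := b k) (c := 2 * β) ?_ ?_ ?_ ⟨0, ?_⟩ ⟨0, ?_⟩ ?_
      (mul_ne_zero hchar hk) ?_ hmod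
    · simpa [add_mul, mul_add, smul_mul_assoc, mul_smul_comm, hil, hli', smul_smul] using hnull
    · simpa [sub_mul, mul_sub, smul_mul_assoc, mul_smul_comm, hil, hli', smul_smul] using hnull
    · rcases Nat.eq_or_lt_of_le hk1 with h | h
      · have hk1' : k = 1 := Fin.ext h.symm
        rw [hk1', hb.one_sq]; exact zero_mem _
      · exact hb.sq_mem k h
    · simp [add_mul, smul_mul_assoc, hik', hlk]
    · simp [mul_add, mul_smul_comm, hki', hkl']
    · have h := sub_mem hy (Submodule.smul_mem _ (t * t) hx)
      have e : (b i + t • b l) * (b i - t • b l) - (2 * β) • b k = b i * b i - β • b k -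
          (t * t) • (b l * b l - α • b k) := by
        simp only [add_mul, mul_sub, smul_mul_assoc, mul_smul_comm, hil, hli', smul_zero, smul_sub,
          smul_smul, htα]
        module
      rwa [e]
    · intro x y z h
      have ei := mem_flag.1 h i (by omega)
      have el := mem_flag.1 h l (by omega)
      have ek := mem_flag.1 h k le_rfl
      simp [hli, hli.symm, hkl, hkl.symm, hki, hki.symm] at ei el ek
      have hxy : x = -y := eq_neg_of_add_eq_zero_left ei
      subst hxy
      have h2 : 2 * t * y = 0 := by linear_combination -el
      have hy0 : y = 0 := (_root_.mul_eq_zero.1 h2).resolve_left (mul_ne_zero hchar ht0)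
      subst hy0
      exact ⟨neg_zero, rfl, ek⟩

end IsFlagBasis

end Lattice

/-! ### The quotient by the ideal spanned by `u` -/

section Quotient

variable {K : Type u} {A : Type v} [Field K] [NonUnitalNonAssocRing A] [Module K A]

theorem map_proj_top {J : Submodule K A} (hJ : IsIdeal J) :
    (⊤ : Submodule K A).map (QuotAlg.proj J hJ) = ⊤ := by
  rw [Submodule.map_top, LinearMap.range_eq_top]
  exact QuotAlg.proj_surjective J hJ

theorem proj_eq_zero_iff {J : Submodule K A} (hJ : IsIdeal J) {x : A} :
    QuotAlg.proj J hJ x = 0 ↔ x ∈ J := by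
  rw [← map_zero (QuotAlg.proj J hJ), QuotAlg.proj_eq_proj_iff, sub_zero]

theorem finrank_quot {n : ℕ} {b : Module.Basis (Fin (n + 2)) K A} {J : Submodule K A}
    (hJ : IsIdeal J) (hJu : J = Submodule.span K {b 0}) :
    Module.finrank K (QuotAlg J hJ) = n + 1 := by
  have := Module.Basis.finiteDimensional_of_finite b
  have h1 : Module.finrank K (A ⧸ J) + Module.finrank K J = Module.finrank K A :=
    Submodule.finrank_quotient_add_finrank J
  have h2 : Module.finrank K J = 1 := by rw [hJu, finrank_span_singleton (b.ne_zero 0)]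
  rw [Module.finrank_eq_card_basis b, Fintype.card_fin, h2] at h1
  exact Nat.add_right_cancel h1

/-- The images of the basis vectors other than `u` form a natural basis of the quotient. -/
theorem IsFlagBasis.isEvolution_quot {n : ℕ} {b : Module.Basis (Fin (n + 2)) K A}
    {J : Submodule K A} (hb : IsFlagBasis b) (hJ : IsIdeal J)
    (hJu : J = Submodule.span K {b 0}) : IsEvolution K (QuotAlg J hJ) := by
  let g : Fin (n + 1) → QuotAlg J hJ := fun i => QuotAlg.proj J hJ (b i.succ)
  have hspan : ⊤ ≤ Submodule.span K (Set.range g) := by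
    rw [← map_proj_top hJ, ← b.span_eq, Submodule.map_span, Submodule.span_le]
    rintro _ ⟨_, ⟨i, rfl⟩, rfl⟩
    refine Fin.cases ?_ (fun i => Submodule.subset_span ⟨i, rfl⟩) i
    have h : QuotAlg.proj J hJ (b 0) = 0 := by
      rw [proj_eq_zero_iff, hJu]
      exact Submodule.mem_span_singleton_self _
    rw [h]
    exact zero_mem _
  refine ⟨n + 1, basisOfTopLeSpanOfCardEqFinrank g hspan (by
    rw [Fintype.card_fin, finrank_quot hJ hJu]), fun i j hij => ?_⟩
  rw [coe_basisOfTopLeSpanOfCardEqFinrank]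
  simp only [g]
  have h2 : 2 ≤ (i.succ : Fin (n + 2)).1 ∨ 2 ≤ (j.succ : Fin (n + 2)).1 := by
    have : i.1 ≠ j.1 := fun h => hij (Fin.ext h)
    simp only [Fin.val_succ]; omega
  rw [← QuotAlg.proj_mul, hb.mul_eq_zero _ _ (fun h => hij (Fin.succ_injective _ h)) h2, map_zero]

variable [IsScalarTower K A A] [SMulCommClass K A A]

theorem map_proj_prod {J : Submodule K A} (hJ : IsIdeal J) (P Q : Submodule K A) :
    (prod P Q).map (QuotAlg.proj J hJ) =
      prod (P.map (QuotAlg.proj J hJ)) (Q.map (QuotAlg.proj J hJ)) := by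
  apply le_antisymm
  · rw [Submodule.map_le_iff_le_comap, prod_le]
    intro x hx y hy
    exact mul_mem_prod (Submodule.mem_map_of_mem hx) (Submodule.mem_map_of_mem hy)
  · rw [prod_le]
    rintro _ ⟨x, hx, rfl⟩ _ ⟨y, hy, rfl⟩
    rw [← QuotAlg.proj_mul]
    exact Submodule.mem_map_of_mem (mul_mem_prod hx hy)

namespace IsFlagBasis

variable {n : ℕ} {b : Module.Basis (Fin (n + 2)) K A} {J : Submodule K A}

theorem isNilp_quot (hb : IsFlagBasis b) (hJ : IsIdeal J)
    (hJu : J = Submodule.span K {b 0}) : IsNilp K (QuotAlg J hJ) := by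
  refine IsNilp.of_filtration (n := n + 1)
    (fun i => (flag b (i + 1)).map (QuotAlg.proj J hJ)) ?_ ?_ fun i => ?_
  · rw [eq_bot_iff]
    rintro _ ⟨x, hx, rfl⟩
    rw [Submodule.mem_bot, proj_eq_zero_iff, hJu, eq_smul_of_mem_flag_one hx]
    exact Submodule.smul_mem _ _ (Submodule.mem_span_singleton_self _)
  · rw [flag_top, map_proj_top]
  · rw [← map_proj_top hJ, ← map_proj_prod, ← map_proj_prod]
    refine ⟨Submodule.map_mono (prod_le.2 fun x hx y _ => ?_),
      Submodule.map_mono (prod_le.2 fun x _ y hy => ?_)⟩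
    · exact hb.mul_mem_flag (by omega) y hx
    · rw [hb.mul_comm']
      exact hb.mul_mem_flag (by omega) x hy

theorem hasMaxNilIndex_quot (hb : IsFlagBasis b) (hr : IsRegular b) (hJ : IsIdeal J)
    (hJu : J = Submodule.span K {b 0}) : HasMaxNilIndex K (QuotAlg J hJ) := by
  have hf := finrank_quot hJ hJu
  refine hasMaxNilIndex_of_lt (hb.isEvolution_quot hJ hJu) (hb.isNilp_quot hJ hJu)
    (by omega) ?_
  rw [hf]
  refine lt_nilIndex_of_filtration (hb.isNilp_quot hJ hJu)
    (V := fun i => (flag b (i + 1)).map (QuotAlg.proj J hJ)) (fun i hi => ?_) (by omega) ?_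
  · rw [← map_proj_prod]
    exact Submodule.map_mono (hb.flag_le_prod hr (by omega))
  · intro h
    have h1 : QuotAlg.proj J hJ (b 1) ∈ (flag b (1 + 1)).map (QuotAlg.proj J hJ) :=
      Submodule.mem_map_of_mem (basis_mem_flag (by simp))
    rw [h, Submodule.mem_bot, proj_eq_zero_iff, hJu, Submodule.mem_span_singleton] at h1
    obtain ⟨s, hs⟩ := h1
    have := congrArg (fun x => b.repr x 1) hs
    simp at this

theorem isRegular_of_hasMaxNilIndex_quot (hb : IsFlagBasis b) (hJ : IsIdeal J)
    (hJu : J = Submodule.span K {b 0}) (h : HasMaxNilIndex K (QuotAlg J hJ)) :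
    IsRegular b := by
  have := Module.Basis.finiteDimensional_of_finite b
  have hf := finrank_quot hJ hJu
  have : FiniteDimensional K (QuotAlg J hJ) :=
    FiniteDimensional.of_finrank_pos (by omega)
  have h1 := h.finrank_le
  rw [hf, ← map_proj_top hJ, ← map_proj_prod] at h1
  refine hb.isRegular_of_finrank_le ?_
  -- the projection of `A ^ 2` has the nonzero vector `u = u w` in its kernel
  have h2 := LinearMap.finrank_range_add_finrank_ker
    ((QuotAlg.proj J hJ).domRestrict (prod (⊤ : Submodule K A) ⊤))
  rw [LinearMap.range_domRestrict] at h2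
  have hu : b 0 ∈ prod (⊤ : Submodule K A) ⊤ := by
    rw [← hb.zero_one]
    exact mul_mem_prod trivial trivial
  have h3 : 1 ≤ Module.finrank K
      ((QuotAlg.proj J hJ).domRestrict (prod (⊤ : Submodule K A) ⊤)).ker := by
    rw [Submodule.one_le_finrank_iff, Submodule.ne_bot_iff]
    refine ⟨⟨b 0, hu⟩, ?_, fun h => b.ne_zero 0 (congrArg Subtype.val h)⟩
    rw [LinearMap.mem_ker, LinearMap.domRestrict_apply, proj_eq_zero_iff, hJu]
    exact Submodule.mem_span_singleton_self _
  omega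

end IsFlagBasis

end Quotient

/-! ### The normal form -/

section NormalForm

variable {K : Type u} {A : Type v} [Field K] [NonUnitalNonAssocRing A] [Module K A]

theorem IsNatural.reindex {ι κ : Type*} {b : Module.Basis ι K A} (hb : IsNatural b)
    (e : ι ≃ κ) : IsNatural (b.reindex e) := by
  intro i j hij
  rw [Module.Basis.reindex_apply, Module.Basis.reindex_apply]
  exact hb _ _ fun h => hij (e.symm.injective h)

theorem structureMatrix_reindex {ι κ : Type*} (b : Module.Basis ι K A) (e : ι ≃ κ) (i k : κ) :
    structureMatrix (b.reindex e) i k = structureMatrix b (e.symm i) (e.symm k) := by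
  simp [structureMatrix]

theorem IsNatural.isEvolution {ι : Type*} [Fintype ι] {b : Module.Basis ι K A}
    (hb : IsNatural b) : IsEvolution K A :=
  ⟨_, _, hb.reindex (Fintype.equivFin ι)⟩

variable [IsScalarTower K A A] [SMulCommClass K A A]

theorem IsNatural.isUnitSMul {ι : Type*} {b : Module.Basis ι K A} (hb : IsNatural b)
    {w : ι → K} (hw : ∀ i, IsUnit (w i)) : IsNatural (b.isUnitSMul hw) := by
  intro i j hij
  rw [Module.Basis.isUnitSMul_apply, Module.Basis.isUnitSMul_apply, smul_mul_assoc,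
    mul_smul_comm, hb i j hij, smul_zero, smul_zero]

theorem structureMatrix_isUnitSMul {ι : Type*} (b : Module.Basis ι K A)
    {w : ι → K} (hw : ∀ i, IsUnit (w i)) (i k : ι) :
    structureMatrix (b.isUnitSMul hw) i k = (w k)⁻¹ * (w i * w i) * structureMatrix b i k := by
  simp only [structureMatrix, Matrix.of_apply]
  rw [Module.Basis.isUnitSMul_apply, smul_mul_assoc, mul_smul_comm, smul_smul, map_smul,
    Finsupp.smul_apply, Module.Basis.repr_isUnitSMul]
  rw [Units.smul_def, Units.val_inv_eq_inv_val, IsUnit.unit_spec]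
  simp only [smul_eq_mul]
  ring

/-- In the normal form, `e_1 + e_2`, `(e_1 - e_2) / 2` and the remaining basis vectors form a flag
basis. -/
theorem exists_isFlagBasis (hchar : (2 : K) ≠ 0) {q : ℕ}
    {B : Module.Basis (Fin 2 ⊕ Fin q) K A} (hB : IsNatural B) {C : Matrix (Fin q) (Fin 2) K}
    {L : Matrix (Fin q) (Fin q) K}
    (hM : structureMatrix B = Matrix.fromBlocks !![1, 1; -1, -1] 0 C L)
    (hL : ∀ i j, i ≤ j → L i j = 0) :
    ∃ b : Module.Basis (Fin (q + 2)) K A, IsFlagBasis b ∧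
      b 0 = B (.inl 0) + B (.inl 1) ∧ (∀ j : Fin q, b j.succ.succ = B (.inr j)) ∧
      ∀ (j : Fin q) (x : A), b.repr x j.succ.succ = B.repr x (.inr j) := by
  have hrepr : ∀ i k, B.repr (B i * B i) k =
      Matrix.fromBlocks !![1, 1; -1, -1] 0 C L i k := fun i k => by rw [← hM]; rfl
  let u : A := B (.inl 0) + B (.inl 1)
  let w : A := (2 : K)⁻¹ • (B (.inl 0) - B (.inl 1))
  let g : Fin (q + 2) → A := Fin.cons u (Fin.cons w fun j => B (.inr j))
  have e0 : B (.inl 0) = (2 : K)⁻¹ • u + w := by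
    simp only [u, w]
    rw [← smul_add, add_add_sub_cancel, ← two_smul K, smul_smul, inv_mul_cancel₀ hchar, one_smul]
  have e1 : B (.inl 1) = (2 : K)⁻¹ • u - w := by
    simp only [u, w]
    rw [← smul_sub, add_sub_sub_cancel, ← two_smul K, smul_smul, inv_mul_cancel₀ hchar, one_smul]
  have hu : u ∈ Submodule.span K (Set.range g) := Submodule.subset_span ⟨0, rfl⟩
  have hw : w ∈ Submodule.span K (Set.range g) := Submodule.subset_span ⟨1, rfl⟩
  have hspan : ⊤ ≤ Submodule.span K (Set.range g) := by
    rw [← B.span_eq, Submodule.span_le]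
    rintro _ ⟨i | j, rfl⟩
    · fin_cases i
      · change B (.inl 0) ∈ _
        rw [e0]
        exact add_mem (Submodule.smul_mem _ _ hu) hw
      · change B (.inl 1) ∈ _
        rw [e1]
        exact sub_mem (Submodule.smul_mem _ _ hu) hw
    · exact Submodule.subset_span ⟨j.succ.succ, rfl⟩
  let b : Module.Basis (Fin (q + 2)) K A := basisOfTopLeSpanOfCardEqFinrank g hspan (by
    rw [Module.finrank_eq_card_basis B, Fintype.card_sum, Fintype.card_fin, Fintype.card_fin,
      Fintype.card_fin, add_comm])
  have hbg : ∀ i, b i = g i := fun i => by simp [b]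
  have b0 : b 0 = u := hbg 0
  have b1 : b 1 = w := hbg 1
  have bs : ∀ j : Fin q, b j.succ.succ = B (.inr j) := fun j => hbg j.succ.succ
  have sq0 : B (.inl 0) * B (.inl 0) = u := by
    rw [← B.sum_repr (B (.inl 0) * B (.inl 0))]
    simp [hrepr, u]
  have sq1 : B (.inl 1) * B (.inl 1) = -u := by
    rw [← B.sum_repr (B (.inl 1) * B (.inl 1))]
    simp [hrepr, u]
    abel
  have m01 : B (.inl 0) * B (.inl 1) = 0 := hB _ _ (by simp)
  have m10 : B (.inl 1) * B (.inl 0) = 0 := hB _ _ (by simp)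
  have l : ∀ (i : Fin 2) (j : Fin q), B (.inl i) * B (.inr j) = 0 := fun i j => hB _ _ (by simp)
  have r : ∀ (i : Fin 2) (j : Fin q), B (.inr j) * B (.inl i) = 0 := fun i j => hB _ _ (by simp)
  refine ⟨b, ⟨?_, ?_, ?_, ?_, ?_, ?_⟩, b0, bs, ?_⟩
  · rw [b0]
    simp only [u, add_mul, mul_add, m01, m10, sq0, sq1]
    simp
  · rw [b1]
    simp only [w, sub_mul, mul_sub, m01, m10, sq0, sq1, smul_mul_assoc, mul_smul_comm]
    simp
  · rw [b0, b1]
    conv_lhs => simp only [u, w]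
    simp only [add_mul, mul_sub, m01, m10, sq0, sq1, mul_smul_comm]
    rw [show u + 0 - (0 + -u) = (2 : K) • u by rw [two_smul]; abel, smul_smul,
      inv_mul_cancel₀ hchar, one_smul]
  · rw [b0, b1]
    conv_lhs => simp only [u, w]
    simp only [mul_add, sub_mul, m01, m10, sq0, sq1, smul_mul_assoc]
    rw [← smul_add, show u - 0 + (0 - -u) = (2 : K) • u by rw [two_smul]; abel, smul_smul,
      inv_mul_cancel₀ hchar, one_smul]
  · have hl : ∀ (i : Fin (q + 2)) (j : Fin q), i ≠ j.succ.succ →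
        b i * b j.succ.succ = 0 ∧ b j.succ.succ * b i = 0 := by
      intro i j hij
      rw [bs]
      induction i using Fin.cases with
      | zero => rw [b0]; simp [u, add_mul, mul_add, l, r]
      | succ i =>
        induction i using Fin.cases with
        | zero =>
          change b 1 * _ = 0 ∧ _ * b 1 = 0
          rw [b1]
          simp [w, sub_mul, mul_sub, l, r, smul_mul_assoc, mul_smul_comm]
        | succ i =>
          rw [bs]
          have hne : i ≠ j := fun h => hij (by rw [h])
          exact ⟨hB _ _ (by simpa using hne), hB _ _ (by simpa using hne.symm)⟩
    intro i j hij h2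
    rcases h2 with h2 | h2
    · obtain ⟨i', rfl⟩ : ∃ i' : Fin q, i = i'.succ.succ :=
        ⟨⟨i.1 - 2, by omega⟩, Fin.ext (by simp only [Fin.val_succ]; omega)⟩
      exact (hl j i' hij.symm).2
    · obtain ⟨j', rfl⟩ : ∃ j' : Fin q, j = j'.succ.succ :=
        ⟨⟨j.1 - 2, by omega⟩, Fin.ext (by simp only [Fin.val_succ]; omega)⟩
      exact (hl i j' hij).1
  · intro i h2
    obtain ⟨i', rfl⟩ : ∃ i' : Fin q, i = i'.succ.succ :=
      ⟨⟨i.1 - 2, by omega⟩, Fin.ext (by simp only [Fin.val_succ]; omega)⟩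
    have hu : u ∈ flag b (i'.succ.succ : Fin (q + 2)).1 := by
      rw [← b0]; exact basis_mem_flag (by simp)
    have hw : w ∈ flag b (i'.succ.succ : Fin (q + 2)).1 := by
      rw [← b1]; exact basis_mem_flag (by simp)
    rw [bs, ← B.sum_repr (B (.inr i') * B (.inr i'))]
    refine Submodule.sum_mem _ fun s _ => ?_
    rcases s with s | t
    · refine Submodule.smul_mem _ _ ?_
      fin_cases s
      · change B (.inl 0) ∈ _
        rw [e0]
        exact add_mem (Submodule.smul_mem _ _ hu) hw
      · change B (.inl 1) ∈ _
        rw [e1]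
        exact sub_mem (Submodule.smul_mem _ _ hu) hw
    · rw [hrepr, Matrix.fromBlocks_apply₂₂]
      by_cases ht : i' ≤ t
      · rw [hL _ _ ht, zero_smul]; exact zero_mem _
      · rw [← bs]
        refine Submodule.smul_mem _ _ (basis_mem_flag ?_)
        simp only [Fin.val_succ]
        have : t.1 < i'.1 := not_le.1 ht
        omega
  · intro j x
    have h : b.coord j.succ.succ = B.coord (.inr j) := by
      refine b.ext fun i => ?_
      rw [Module.Basis.coord_apply, Module.Basis.coord_apply, Module.Basis.repr_self]
      induction i using Fin.cases with
      | zero => rw [b0]; simp [u, Fin.ext_iff]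
      | succ i =>
        induction i using Fin.cases with
        | zero =>
          change (Finsupp.single 1 1) _ = B.repr (b 1) _
          rw [b1]
          simp [w, Fin.ext_iff]
        | succ i =>
          rw [bs, Module.Basis.repr_self]
          simp [Finsupp.single_apply]
    exact LinearMap.congr_fun h x

end NormalForm

/-! ### The algebras `E_k(λ_1, …, λ_n)` -/

section Ek

variable {K : Type u} [Field K] {n k : ℕ} {lam : Fin n → K}

/-- If `λ_1, …, λ_k` all vanish, then every product annihilates the algebra. -/
theorem exists_lam_ne_zero (hnil : ¬ IsNilp K (Ek k lam)) : ∃ a : Fin n, a.1 < k ∧ lam a ≠ 0 := by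
  by_contra! h
  refine hnil ⟨3, by omega, le_bot_iff.1 ?_⟩
  -- the coordinates of a product vanish from `k` on, and such vectors annihilate the algebra
  have hann : ∀ x y z : Ek k lam, ∀ i : Fin n, ∀ j, (x * y) i * z i * ekMatrix k lam i j = 0 := by
    intro x y z i j
    by_cases hi : i.1 < k
    · simp [ekMatrix, h i hi]
    · have : (x * y) i = 0 := by
        rw [EvAlg.mul_apply]
        exact Finset.sum_eq_zero fun l _ => by simp [ekMatrix, hi]
      rw [this, zero_mul, zero_mul]
  have hmul : ∀ x ∈ prod (⊤ : Submodule K (Ek k lam)) ⊤, ∀ y, x * y = 0 ∧ y * x = 0 := by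
    intro x hx y
    have hle : prod (⊤ : Submodule K (Ek k lam)) ⊤ ≤
        LinearMap.ker ((LinearMap.mul K (Ek k lam)).flip y) ⊓
          LinearMap.ker (LinearMap.mul K (Ek k lam) y) := by
      refine prod_le.2 fun x₁ _ x₂ _ => ?_
      have h1 : x₁ * x₂ * y = 0 := funext fun j => by
        rw [EvAlg.mul_apply, EvAlg.zero_apply]
        exact Finset.sum_eq_zero fun i _ => hann x₁ x₂ y i j
      have h2 : y * (x₁ * x₂) = 0 := funext fun j => by
        rw [EvAlg.mul_apply, EvAlg.zero_apply]
        exact Finset.sum_eq_zero fun i _ => by rw [mul_comm (y i)]; exact hann x₁ x₂ y i j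
      exact ⟨h1, h2⟩
    exact ⟨(hle hx).1, (hle hx).2⟩
  refine power_le K _ (by omega) fun a b ha hb hab => prod_le.2 fun x hx y hy => ?_
  rw [Submodule.mem_bot]
  obtain ⟨rfl, rfl⟩ | ⟨rfl, rfl⟩ : a = 2 ∧ b = 1 ∨ a = 1 ∧ b = 2 := by omega
  · rw [power_two] at hx; exact (hmul x hx y).1
  · rw [power_two] at hy; exact (hmul y hy x).2

theorem exists_lam_ne_zero_ne (hpar : IsEkParam k lam) {a : Fin n} (ha : a.1 < k)
    (hlam : lam a ≠ 0) : ∃ c : Fin n, c.1 < k ∧ c ≠ a := by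
  by_contra! h
  refine hlam ?_
  rw [← hpar.2.2.2, Finset.sum_eq_single a]
  · intro c hc hca
    exact absurd (h c (Finset.mem_filter.1 hc).2) hca
  · intro hna
    exact absurd (Finset.mem_filter.2 ⟨Finset.mem_univ a, ha⟩) hna

theorem two_le_of_not_isNilp (hpar : IsEkParam k lam) (hnil : ¬ IsNilp K (Ek k lam)) :
    2 ≤ k ∧ 2 ≤ n := by
  obtain ⟨a, ha, hlam⟩ := exists_lam_ne_zero hnil
  obtain ⟨c, hc, hca⟩ := exists_lam_ne_zero_ne hpar ha hlam
  have : c.1 ≠ a.1 := fun h => hca (Fin.ext h)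
  have := a.2
  have := c.2
  omega

/-- In dimension two, the parameters are `k = 2` and `(μ, -μ)` with `μ ≠ 0`. -/
theorem exists_param_of_two {lam : Fin 2 → K} (hpar : IsEkParam k lam)
    (hnil : ¬ IsNilp K (Ek k lam)) : k = 2 ∧ lam 0 ≠ 0 ∧ lam 1 = -lam 0 := by
  have hk := (two_le_of_not_isNilp hpar hnil).1
  have hk2 := hpar.2.1
  have hsum := hpar.2.2.2
  have h1 : lam 1 = -lam 0 := by
    rw [Finset.filter_true_of_mem (fun i _ => by omega), Fin.sum_univ_two] at hsum
    exact (neg_eq_of_add_eq_zero_right hsum).symm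
  refine ⟨by omega, fun h0 => ?_, h1⟩
  obtain ⟨i, hi⟩ := hpar.2.2.1
  fin_cases i
  · exact hi h0
  · exact hi (by simp [h1, h0])

/-- Multiplication by `μ` is an isomorphism from `E_2(μ, -μ)` to `E_2(1, -1)`. -/
theorem isomorphic_of_two (hn : n = 2) (hpar : IsEkParam k lam)
    (hnil : ¬ IsNilp K (Ek k lam)) : Isomorphic K (Ek k lam) (Ek 2 ![(1 : K), -1]) := by
  subst hn
  obtain ⟨rfl, h0, h1⟩ := exists_param_of_two hpar hnil
  let g : Ek 2 lam → Ek 2 ![(1 : K), -1] := fun x => (fun i => lam 0 * x i : Fin 2 → K)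
  have hg : ∀ x i, g x i = lam 0 * x i := fun _ _ => rfl
  have hmul : ∀ x y, g (x * y) = g x * g y := fun x y => funext fun i => by
    rw [hg, EvAlg.mul_apply, EvAlg.mul_apply, Fin.sum_univ_two, Fin.sum_univ_two, hg, hg, hg, hg]
    fin_cases i <;> simp [ekMatrix, h1] <;> ring
  let f : Ek 2 lam →ₙₐ[K] Ek 2 ![(1 : K), -1] :=
    { toFun := g
      map_smul' := fun c x => funext fun i => mul_left_comm _ _ _
      map_zero' := funext fun i => mul_zero _
      map_add' := fun x y => funext fun i => mul_add _ _ _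
      map_mul' := hmul }
  refine ⟨f, fun x y hxy => funext fun i => mul_left_cancel₀ h0 (congrFun hxy i),
    fun y => ⟨(fun i => (lam 0)⁻¹ * y i : Fin 2 → K), funext fun i => ?_⟩⟩
  exact mul_inv_cancel_left₀ h0 _

end Ek

/-! ### Members of the family -/

section Family

variable {K : Type u} [Field K] {A : Type v} [NonUnitalNonAssocRing A] [Module K A]
  {r : ℕ} {d k : Fin r → ℕ} {lam : ∀ i, Fin (d i) → K} {p : ℕ}
  {B : Module.Basis ((Σ i : Fin r, Fin (d i)) ⊕ Fin p) K A}

/-- The sum of the first `k i` vectors of the `i`-th block, which spans the square of the block. -/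
noncomputable def blockSum (B : Module.Basis ((Σ i : Fin r, Fin (d i)) ⊕ Fin p) K A) (k : Fin r → ℕ)
    (i : Fin r) : A :=
  ∑ a : Fin (d i) with a.1 < k i, B (.inl ⟨i, a⟩)

theorem repr_blockSum_self (i : Fin r) (a : Fin (d i)) :
    B.repr (blockSum B k i) (.inl ⟨i, a⟩) = if a.1 < k i then 1 else 0 := by
  rw [blockSum, map_sum, Finsupp.finsetSum_apply, Finset.sum_filter, Finset.sum_eq_single a]
  · simp
  · intro c _ hc
    rw [Module.Basis.repr_self, Finsupp.single_eq_of_ne (by simpa using hc.symm), ite_self]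
  · simp

theorem repr_blockSum_of_ne {i j : Fin r} (hij : i ≠ j) (a : Fin (d j)) :
    B.repr (blockSum B k i) (.inl ⟨j, a⟩) = 0 := by
  simp [blockSum, hij]

theorem repr_blockSum_inr (i : Fin r) (t : Fin p) :
    B.repr (blockSum B k i) (.inr t) = 0 := by
  simp [blockSum]

/-- A vector without coordinates at two of the first `k i` vectors of a block is independent of the
block sum and of one of these two vectors. -/
theorem indep_blockSum {i : Fin r} {a c : Fin (d i)} (ha : a.1 < k i) (hc : c.1 < k i)
    (hca : c ≠ a) {z : A} (hza : B.repr z (.inl ⟨i, a⟩) = 0) (hzc : B.repr z (.inl ⟨i, c⟩) = 0)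
    (hz : z ≠ 0) (α β γ : K)
    (h : α • blockSum B k i + β • B (.inl ⟨i, a⟩) + γ • z = 0) : α = 0 ∧ β = 0 ∧ γ = 0 := by
  have h1 := congrArg (fun x => B.repr x (.inl ⟨i, c⟩)) h
  have h2 := congrArg (fun x => B.repr x (.inl ⟨i, a⟩)) h
  simp only [map_add, map_smul, Finsupp.add_apply, Finsupp.smul_apply, repr_blockSum_self, ha, hc,
    hza, hzc, Module.Basis.repr_self, if_true, smul_eq_mul, mul_one, mul_zero, add_zero, map_zero,
    Finsupp.zero_apply, Finsupp.single_eq_same] at h1 h2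
  rw [Finsupp.single_eq_of_ne (by simpa using hca), mul_zero, add_zero] at h1
  subst h1
  rw [zero_add] at h2
  subst h2
  rw [zero_smul, zero_smul, zero_add, zero_add] at h
  exact ⟨rfl, rfl, (smul_eq_zero.1 h).resolve_right hz⟩

namespace IsFamilyBasis

theorem sq_eq (hB : IsFamilyBasis k lam B) (i : Fin r) (a : Fin (d i)) :
    B (.inl ⟨i, a⟩) * B (.inl ⟨i, a⟩) = lam i a • blockSum B k i := by
  obtain ⟨-, C, L, -, hM⟩ := hB
  apply B.ext_elem
  intro s
  have hs : B.repr (B (.inl ⟨i, a⟩) * B (.inl ⟨i, a⟩)) s =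
      structureMatrix B (.inl ⟨i, a⟩) s := rfl
  rw [hs, hM, map_smul, Finsupp.smul_apply]
  rcases s with ⟨j, c⟩ | t
  · by_cases hij : i = j
    · subst hij
      rw [repr_blockSum_self, Matrix.fromBlocks_apply₁₁, Matrix.blockDiagonal'_apply_eq]
      simp [ekMatrix]
    · rw [repr_blockSum_of_ne hij, Matrix.fromBlocks_apply₁₁,
        Matrix.blockDiagonal'_apply_ne _ _ _ hij, smul_zero]
  · rw [repr_blockSum_inr, Matrix.fromBlocks_apply₁₂, smul_zero]
    rfl

theorem mul_blockSum (hB : IsFamilyBasis k lam B) (i : Fin r) (a : Fin (d i)) :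
    B (.inl ⟨i, a⟩) * blockSum B k i = (if a.1 < k i then lam i a else 0) • blockSum B k i ∧
    blockSum B k i * B (.inl ⟨i, a⟩) = (if a.1 < k i then lam i a else 0) • blockSum B k i := by
  have hne : ∀ c : Fin (d i), c ≠ a → (Sum.inl ⟨i, c⟩ : (Σ i : Fin r, Fin (d i)) ⊕ Fin p) ≠
      .inl ⟨i, a⟩ := fun c hc h => hc (by simpa using h)
  constructor
  · conv_lhs => rw [blockSum]
    rw [Finset.mul_sum, Finset.sum_filter, Finset.sum_eq_single a]
    · rw [hB.sq_eq, ite_smul, zero_smul]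
    · intro c _ hc
      rw [hB.1 _ _ (hne c hc).symm, ite_self]
    · simp
  · conv_lhs => rw [blockSum]
    rw [Finset.sum_mul, Finset.sum_filter, Finset.sum_eq_single a]
    · rw [hB.sq_eq, ite_smul, zero_smul]
    · intro c _ hc
      rw [hB.1 _ _ (hne c hc), ite_self]
    · simp

theorem mul_blockSum_of_ne (hB : IsFamilyBasis k lam B) {i j : Fin r} (hij : i ≠ j)
    (a : Fin (d j)) :
    B (.inl ⟨j, a⟩) * blockSum B k i = 0 ∧ blockSum B k i * B (.inl ⟨j, a⟩) = 0 := by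
  have hne : ∀ c : Fin (d i), (Sum.inl ⟨i, c⟩ : (Σ i : Fin r, Fin (d i)) ⊕ Fin p) ≠
      .inl ⟨j, a⟩ := fun c h => hij (Sigma.mk.inj_iff.1 (Sum.inl.inj h)).1
  rw [blockSum, Finset.mul_sum, Finset.sum_mul]
  exact ⟨Finset.sum_eq_zero fun c _ => hB.1 _ _ (hne c).symm,
    Finset.sum_eq_zero fun c _ => hB.1 _ _ (hne c)⟩

theorem blockSum_mul_of_ne (hB : IsFamilyBasis k lam B) {i j : Fin r} (hij : i ≠ j) :
    blockSum B k i * blockSum B k j = 0 := by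
  conv_lhs => rw [blockSum.eq_def B k j]
  rw [Finset.mul_sum]
  exact Finset.sum_eq_zero fun a _ => (hB.mul_blockSum_of_ne hij a).2

theorem blockSum_sq (hB : IsFamilyBasis k lam B) {i : Fin r} (hpar : IsEkParam (k i) (lam i)) :
    blockSum B k i * blockSum B k i = 0 := by
  conv_lhs => rw [congrArg (blockSum B k i * ·) (blockSum.eq_def B k i)]
  simp only [Finset.mul_sum]
  rw [Finset.sum_congr rfl fun a ha => by
    rw [(hB.mul_blockSum i a).2, if_pos (Finset.mem_filter.1 ha).2]]
  rw [← Finset.sum_smul, hpar.2.2.2, zero_smul]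

end IsFamilyBasis

variable [IsScalarTower K A A] [SMulCommClass K A A]

/-- The vectors `u` and `e` span a copy of `E_2(μ, -μ)`, with `e` and `u - e` as its natural basis;
the hyperbolic partner of `u` in it is `(e - u / 2) / μ`. -/
theorem not_isModular_of_extra (hchar : (2 : K) ≠ 0) {u e z : A} {μ s c : K} (hμ : μ ≠ 0)
    (huu : u * u = 0) (hue : u * e = μ • u) (heu : e * u = μ • u) (hee : e * e = μ • u)
    (huz : u * z = s • u) (hzu : z * u = s • u) (hez : e * z = 0) (hze : z * e = 0)
    (hzz : z * z = c • u)
    (hind : ∀ α β γ : K, α • u + β • e + γ • z = 0 → α = 0 ∧ β = 0 ∧ γ = 0) :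
    ¬ IsModular K A := by
  refine not_isModular_of_hyperbolic hchar (u := u) (w := μ⁻¹ • e - (2 * μ)⁻¹ • u) (z := z)
    (s := s) (t := -((2 * μ)⁻¹ * s)) (c := c) huu ?_ ?_ ?_ huz hzu ?_ ?_ hzz ?_
  · have h : (μ⁻¹ • e - (2 * μ)⁻¹ • u) * (μ⁻¹ • e - (2 * μ)⁻¹ • u) =
        (μ⁻¹ * (μ⁻¹ * μ) - 2 * (μ⁻¹ * ((2 * μ)⁻¹ * μ))) • u := by
      simp only [sub_mul, mul_sub, smul_mul_assoc, mul_smul_comm, huu, hue, heu, hee, smul_zero]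
      module
    rw [h, show μ⁻¹ * (μ⁻¹ * μ) - 2 * (μ⁻¹ * ((2 * μ)⁻¹ * μ)) = 0 by field_simp; ring, zero_smul]
  · simp [mul_sub, mul_smul_comm, hue, huu, smul_smul, hμ]
  · simp [sub_mul, smul_mul_assoc, heu, huu, smul_smul, hμ]
  · simp [sub_mul, smul_mul_assoc, hez, huz, smul_smul]
  · simp [mul_sub, mul_smul_comm, hze, hzu, smul_smul]
  · intro α β γ h
    have h' : (α - β * (2 * μ)⁻¹) • u + (β * μ⁻¹) • e + γ • z = 0 := by
      rw [← h]; module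
    obtain ⟨h1, h2, h3⟩ := hind _ _ _ h'
    have hβ : β = 0 := (mul_eq_zero.1 h2).resolve_right (inv_ne_zero hμ)
    subst hβ
    exact ⟨by simpa using h1, rfl, h3⟩

namespace IsFamilyBasis

/-- The block sum of a second block would be a further vector as in `not_isModular_of_extra`. -/
theorem eq_one_of_isModular (hchar : (2 : K) ≠ 0) (hB : IsFamilyBasis k lam B)
    (hpar : ∀ i, IsEkParam (k i) (lam i)) (hnil : ∀ i, ¬ IsNilp K (Ek (k i) (lam i)))
    (hmod : IsModular K A) (hr : 1 ≤ r) : r = 1 := by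
  by_contra hne
  have hij : (⟨0, by omega⟩ : Fin r) ≠ ⟨1, by omega⟩ := by simp
  generalize (⟨0, by omega⟩ : Fin r) = i at hij
  generalize (⟨1, by omega⟩ : Fin r) = j at hij
  obtain ⟨a, ha, hlam⟩ := exists_lam_ne_zero (hnil i)
  obtain ⟨c, hc, hca⟩ := exists_lam_ne_zero_ne (hpar i) ha hlam
  obtain ⟨a', ha', -⟩ := exists_lam_ne_zero (hnil j)
  refine not_isModular_of_extra hchar (u := blockSum B k i) (e := B (.inl ⟨i, a⟩))
    (z := blockSum B k j) (s := 0) (c := 0) hlam (hB.blockSum_sq (hpar i)) ?_ ?_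
    (hB.sq_eq i a) ?_ ?_ (hB.mul_blockSum_of_ne hij.symm a).1 (hB.mul_blockSum_of_ne hij.symm a).2
    ?_ (indep_blockSum ha hc hca (repr_blockSum_of_ne hij.symm a)
      (repr_blockSum_of_ne hij.symm c) ?_) hmod
  · rw [(hB.mul_blockSum i a).2, if_pos ha]
  · rw [(hB.mul_blockSum i a).1, if_pos ha]
  · rw [hB.blockSum_mul_of_ne hij, zero_smul]
  · rw [hB.blockSum_mul_of_ne hij.symm, zero_smul]
  · rw [hB.blockSum_sq (hpar j), zero_smul]
  · intro h
    have := repr_blockSum_self (B := B) (k := k) j a'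
    rw [h, if_pos ha'] at this
    simp at this

/-- In a block of dimension at least three, a third basis vector would be a further vector as in
`not_isModular_of_extra`. -/
theorem dim_eq_two_of_isModular (hchar : (2 : K) ≠ 0) (hB : IsFamilyBasis k lam B)
    (hpar : ∀ i, IsEkParam (k i) (lam i)) (hnil : ∀ i, ¬ IsNilp K (Ek (k i) (lam i)))
    (hmod : IsModular K A) (i : Fin r) : d i = 2 := by
  by_contra hne
  have h2 := (two_le_of_not_isNilp (hpar i) (hnil i)).2
  obtain ⟨a, ha, hlam⟩ := exists_lam_ne_zero (hnil i)
  obtain ⟨c, hc, hca⟩ := exists_lam_ne_zero_ne (hpar i) ha hlam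
  obtain ⟨x, hx⟩ : ∃ x : Fin (d i), x ∉ ({a, c} : Finset (Fin (d i))) := by
    by_contra! hall
    have h := Finset.card_le_card fun y (_ : y ∈ Finset.univ) => hall y
    have := Finset.card_le_two (a := a) (b := c)
    rw [Finset.card_univ, Fintype.card_fin] at h
    omega
  simp only [Finset.mem_insert, Finset.mem_singleton, not_or] at hx
  have hxa : (Sum.inl ⟨i, x⟩ : (Σ i : Fin r, Fin (d i)) ⊕ Fin p) ≠ .inl ⟨i, a⟩ := by
    simpa using hx.1
  have hxc : (Sum.inl ⟨i, x⟩ : (Σ i : Fin r, Fin (d i)) ⊕ Fin p) ≠ .inl ⟨i, c⟩ := by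
    simpa using hx.2
  refine not_isModular_of_extra hchar (u := blockSum B k i) (e := B (.inl ⟨i, a⟩))
    (z := B (.inl ⟨i, x⟩)) hlam (hB.blockSum_sq (hpar i)) ?_ ?_
    (hB.sq_eq i a) (hB.mul_blockSum i x).2 (hB.mul_blockSum i x).1 (hB.1 _ _ hxa.symm)
    (hB.1 _ _ hxa) (hB.sq_eq i x) (indep_blockSum ha hc hca ?_ ?_ (B.ne_zero _)) hmod
  · rw [(hB.mul_blockSum i a).2, if_pos ha]
  · rw [(hB.mul_blockSum i a).1, if_pos ha]
  · rw [Module.Basis.repr_self, Finsupp.single_eq_of_ne hxa.symm]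
  · rw [Module.Basis.repr_self, Finsupp.single_eq_of_ne hxc.symm]

/-- The square of the algebra is spanned by the `r` block sums and the `p` squares of the further
basis vectors. -/
theorem finrank_prod_top_top_le (hB : IsFamilyBasis k lam B) :
    Module.finrank K (prod (⊤ : Submodule K A) ⊤) ≤ r + p := by
  let g : Fin r ⊕ Fin p → A := Sum.elim (blockSum B k) fun t => B (.inr t) * B (.inr t)
  have hle : prod (⊤ : Submodule K A) ⊤ ≤ Submodule.span K (Set.range g) := by
    rw [prod_top_top_eq_span hB.1, Submodule.span_le]
    rintro _ ⟨⟨i, a⟩ | t, rfl⟩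
    · simp only [hB.sq_eq]
      exact Submodule.smul_mem _ _ (Submodule.subset_span ⟨.inl i, rfl⟩)
    · exact Submodule.subset_span ⟨.inr t, rfl⟩
  have := Module.Basis.finiteDimensional_of_finite B
  have h1 := Submodule.finrank_mono hle
  have h2 : Module.finrank K (Submodule.span K (Set.range g)) ≤ Fintype.card (Fin r ⊕ Fin p) :=
    finrank_range_le_card g
  rw [Fintype.card_sum, Fintype.card_fin, Fintype.card_fin] at h2
  omega

/-- As the blocks have dimension at least two, `2 r + p ≤ dim A ≤ dim A ^ 2 + 1 ≤ r + p + 1`. -/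
theorem of_hasMaxSolvIndex (hB : IsFamilyBasis k lam B)
    (hpar : ∀ i, IsEkParam (k i) (lam i)) (hnil : ∀ i, ¬ IsNilp K (Ek (k i) (lam i)))
    (h : HasMaxSolvIndex K A) (hr : 1 ≤ r) : r = 1 ∧ d ⟨0, hr⟩ = 2 := by
  have := Module.Basis.finiteDimensional_of_finite B
  have h1 := h.finrank_le
  have h2 := hB.finrank_prod_top_top_le
  rw [Module.finrank_eq_card_basis B, Fintype.card_sum, Fintype.card_sigma, Fintype.card_fin] at h1
  simp only [Fintype.card_fin] at h1
  have hd : ∀ i, 2 ≤ d i := fun i => (two_le_of_not_isNilp (hpar i) (hnil i)).2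
  have h3 : r * 2 ≤ ∑ i, d i := by
    have := Finset.card_nsmul_le_sum Finset.univ d 2 fun i _ => hd i
    simpa using this
  have hr1 : r = 1 := by omega
  subst hr1
  refine ⟨rfl, ?_⟩
  have h4 := hd ⟨0, hr⟩
  have e : ∑ i, d i = d ⟨0, hr⟩ := Fin.sum_univ_one d
  omega

theorem prod_block_block (hB : IsFamilyBasis k lam B) {i : Fin r}
    (hnil : ¬ IsNilp K (Ek (k i) (lam i))) :
    prod (block B i) (block B i) = Submodule.span K {blockSum B k i} := by
  apply le_antisymm
  · refine (Submodule.map₂_span_span K (LinearMap.mul K A) _ _).le.trans (Submodule.span_le.2 ?_)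
    rintro _ ⟨_, ⟨a, rfl⟩, _, ⟨c, rfl⟩, rfl⟩
    by_cases hac : a = c
    · subst hac
      simp only [LinearMap.mul_apply', hB.sq_eq]
      exact Submodule.smul_mem _ _ (Submodule.mem_span_singleton_self _)
    · have : B (.inl ⟨i, a⟩) * B (.inl ⟨i, c⟩) = 0 := hB.1 _ _ fun h => hac (by simpa using h)
      simp [this]
  · rw [Submodule.span_singleton_le_iff_mem]
    obtain ⟨a, -, hlam⟩ := exists_lam_ne_zero hnil
    have hm : B (.inl ⟨i, a⟩) ∈ block B i := Submodule.subset_span ⟨a, rfl⟩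
    have h := Submodule.smul_mem _ (lam i a)⁻¹ (mul_mem_prod hm hm)
    rwa [hB.sq_eq, smul_smul, inv_mul_cancel₀ hlam, one_smul] at h

/-- With a single block of dimension two, dividing its two basis vectors by `μ` brings the structure
matrix into normal form. -/
theorem exists_normalForm (hB : IsFamilyBasis k lam B)
    (hpar : ∀ i, IsEkParam (k i) (lam i)) (hnil : ∀ i, ¬ IsNilp K (Ek (k i) (lam i)))
    (hr : 1 ≤ r) (hr1 : r = 1) (hd : d ⟨0, hr⟩ = 2) :
    ∃ (B' : Module.Basis (Fin 2 ⊕ Fin p) K A) (C : Matrix (Fin p) (Fin 2) K)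
      (L : Matrix (Fin p) (Fin p) K), IsNatural B' ∧
      structureMatrix B' = Matrix.fromBlocks !![1, 1; -1, -1] 0 C L ∧
      (∀ i j, i ≤ j → L i j = 0) ∧
      prod (block B ⟨0, hr⟩) (block B ⟨0, hr⟩) =
        Submodule.span K {B' (.inl 0) + B' (.inl 1)} := by
  subst hr1
  have hpar0 := hpar ⟨0, hr⟩
  have hnil0 := hnil ⟨0, hr⟩
  obtain ⟨μ, hμ, hk, h0, h1⟩ : ∃ μ : K, μ ≠ 0 ∧ k ⟨0, hr⟩ = 2 ∧
      lam ⟨0, hr⟩ (Fin.cast hd.symm 0) = μ ∧ lam ⟨0, hr⟩ (Fin.cast hd.symm 1) = -μ := by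
    clear hB
    revert hpar0 hnil0 hd
    generalize lam ⟨0, hr⟩ = lam₀
    revert lam₀
    generalize d ⟨0, hr⟩ = d₀
    rintro lam₀ rfl hpar0 hnil0
    obtain ⟨hk, h0, h1⟩ := exists_param_of_two hpar0 hnil0
    exact ⟨lam₀ 0, h0, hk, rfl, h1⟩
  let e : (Σ i : Fin 1, Fin (d i)) ⊕ Fin p ≃ Fin 2 ⊕ Fin p :=
    (Equiv.sumCongr ((finCongr hd.symm).trans
      (Equiv.uniqueSigma fun i : Fin 1 => Fin (d i)).symm) (Equiv.refl _)).symm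
  have el : ∀ i : Fin 2, e.symm (.inl i) = .inl ⟨⟨0, hr⟩, Fin.cast hd.symm i⟩ := fun i => rfl
  have er : ∀ t : Fin p, e.symm (.inr t) = .inr t := fun t => rfl
  let c : Fin 2 ⊕ Fin p → K := Sum.elim (fun _ => μ⁻¹) fun _ => 1
  have hc : ∀ s, IsUnit (c s) := by
    rintro (i | t)
    · exact (inv_ne_zero hμ).isUnit
    · exact isUnit_one
  obtain ⟨-, C, L, hL, hM⟩ := id hB
  let B' := (B.reindex e).isUnitSMul hc
  have hM' : ∀ s t, structureMatrix B' s t = (c t)⁻¹ * (c s * c s) *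
      Matrix.fromBlocks (Matrix.blockDiagonal' fun i => ekMatrix (k i) (lam i)) 0 C L
        (e.symm s) (e.symm t) := by
    intro s t
    rw [structureMatrix_isUnitSMul, structureMatrix_reindex, hM]
  refine ⟨B', Matrix.of fun t i => structureMatrix B' (.inr t) (.inl i), L,
    (hB.1.reindex e).isUnitSMul hc, ?_, hL, ?_⟩
  · ext s t
    rcases s with i | s <;> rcases t with j | t
    · rw [hM', el, el, Matrix.fromBlocks_apply₁₁, Matrix.fromBlocks_apply₁₁,
        Matrix.blockDiagonal'_apply_eq]
      have hj : (Fin.cast hd.symm j).1 < k ⟨0, hr⟩ := by rw [hk]; exact j.2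
      simp only [ekMatrix, Matrix.of_apply, if_pos hj, c, Sum.elim_inl]
      have hlam : lam ⟨0, hr⟩ (Fin.cast hd.symm i) = ![μ, -μ] i := by
        fin_cases i
        · exact h0
        · exact h1
      rw [hlam]
      fin_cases i <;> fin_cases j <;> simp [hμ]
    · rw [hM', el, er, Matrix.fromBlocks_apply₁₂, Matrix.fromBlocks_apply₁₂]
      simp
    · rfl
    · rw [hM', er, er, Matrix.fromBlocks_apply₂₂, Matrix.fromBlocks_apply₂₂]
      simp [c]
  · rw [hB.prod_block_block hnil0]
    have hsum : blockSum B k ⟨0, hr⟩ = B (.inl ⟨⟨0, hr⟩, Fin.cast hd.symm 0⟩) +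
        B (.inl ⟨⟨0, hr⟩, Fin.cast hd.symm 1⟩) := by
      rw [blockSum, Finset.filter_true_of_mem fun a _ => by rw [hk, ← hd]; exact a.2,
        ← (finCongr hd.symm).sum_comp, Fin.sum_univ_two]
      rfl
    have hB' : B' (.inl 0) + B' (.inl 1) = μ⁻¹ • blockSum B k ⟨0, hr⟩ := by
      simp only [B', Module.Basis.isUnitSMul_apply, Module.Basis.reindex_apply, el, c,
        Sum.elim_inl]
      rw [hsum, smul_add]
    rw [hB', Submodule.span_singleton_smul_eq (inv_ne_zero hμ).isUnit]

end IsFamilyBasis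

end Family

end EvoAlg

/-! ### The equivalence -/

theorem mainTheorem2 {K : Type u} [Field K] (hchar : ringChar K ≠ 2)
    (hquad : ∀ a : K, IsSquare a)
    {r : ℕ} (hr : 1 ≤ r) (d k : Fin r → ℕ) (lam : ∀ i, Fin (d i) → K)
    (hpar : ∀ i, IsEkParam (k i) (lam i))
    (hEsolv : ∀ i, IsSolv K (Ek (k i) (lam i)))
    (hEnil : ∀ i, ¬ IsNilp K (Ek (k i) (lam i)))
    {E : Type v} [NonUnitalNonAssocRing E] [Module K E] [IsScalarTower K E E]
    [SMulCommClass K E E] {p : ℕ}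
    (B : Module.Basis ((Σ i : Fin r, Fin (d i)) ⊕ Fin p) K E) (hB : IsFamilyBasis k lam B)
    (hsolv : IsSolv K E) (hnil : ¬ IsNilp K E) :
    List.TFAE
      [IsDistributive K E,
       IsModular K E ∧ IsUpperSemimodular K E,
       r = 1 ∧ Isomorphic K (Ek (k ⟨0, hr⟩) (lam ⟨0, hr⟩)) (Ek 2 ![(1 : K), -1]) ∧
         HasMaxNilIndex K (QuotAlg (prod (block B ⟨0, hr⟩) (block B ⟨0, hr⟩))
           (blockSq_isIdeal hB ⟨0, hr⟩)),
       HasMaxSolvIndex K E] ∧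
    (IsDistributive K E →
      ∃ (q : ℕ) (B' : Module.Basis (Fin 2 ⊕ Fin q) K E) (C : Matrix (Fin q) (Fin 2) K)
        (L : Matrix (Fin q) (Fin q) K),
        IsNatural B' ∧
        structureMatrix B' = Matrix.fromBlocks !![1, 1; -1, -1] 0 C L ∧
        (∀ i j, i ≤ j → L i j = 0) ∧
        (∀ i j : Fin q, i.1 = j.1 + 1 → L i j ≠ 0) ∧
        (structureMatrix B').rank + 1 = Module.finrank K E) := by
  have h2 : (2 : K) ≠ 0 := Ring.two_ne_zero hchar
  have hpos : 0 < Module.finrank K E := by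
    obtain ⟨a, -, -⟩ := exists_lam_ne_zero (hEnil ⟨0, hr⟩)
    rw [Module.finrank_eq_card_basis B]
    exact Fintype.card_pos_iff.2 ⟨.inl ⟨⟨0, hr⟩, a⟩⟩
  have := Module.Basis.finiteDimensional_of_finite B
  have hE : IsEvolution K E := hB.1.isEvolution
  -- over a single block of dimension two there is a flag basis
  have core : r = 1 → d ⟨0, hr⟩ = 2 →
      ∃ (B' : Module.Basis (Fin 2 ⊕ Fin p) K E) (C : Matrix (Fin p) (Fin 2) K)
        (L : Matrix (Fin p) (Fin p) K) (b : Module.Basis (Fin (p + 2)) K E),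
        IsNatural B' ∧ structureMatrix B' = Matrix.fromBlocks !![1, 1; -1, -1] 0 C L ∧
        (∀ i j, i ≤ j → L i j = 0) ∧ IsFlagBasis b ∧
        prod (block B ⟨0, hr⟩) (block B ⟨0, hr⟩) = Submodule.span K {b 0} ∧
        (IsRegular b → ∀ i j : Fin p, i.1 = j.1 + 1 → L i j ≠ 0) := by
    intro hr1 hd
    obtain ⟨B', C, L, hB', hM, hL, hJ⟩ := hB.exists_normalForm hpar hEnil hr hr1 hd
    obtain ⟨b, hb, hb0, hbs, hcoord⟩ := exists_isFlagBasis h2 hB' hM hL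
    refine ⟨B', C, L, b, hB', hM, hL, hb, by rw [hJ, hb0], fun hreg i j hij => ?_⟩
    have h := hreg i.succ.succ j.succ.succ (by simp only [Fin.val_succ]; omega)
      (by simp only [Fin.val_succ]; omega)
    rw [hcoord, hbs] at h
    have e : structureMatrix B' (.inr i) (.inr j) = L i j := by rw [hM]; rfl
    rw [← e]
    exact h
  have dims : IsModular K E → r = 1 ∧ d ⟨0, hr⟩ = 2 := fun hmod =>
    ⟨hB.eq_one_of_isModular h2 hpar hEnil hmod hr, hB.dim_eq_two_of_isModular h2 hpar hEnil hmod _⟩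
  constructor
  · tfae_have 1 → 2 := fun h => ⟨h.isModular, h.isModular.isUpperSemimodular⟩
    tfae_have 2 → 4 := fun h => by
      obtain ⟨hr1, hd⟩ := dims h.1
      obtain ⟨B', C, L, b, -, -, -, hb, -, -⟩ := core hr1 hd
      exact hb.hasMaxSolvIndex (hb.isRegular_of_isModular h2 hquad h.1) hE hsolv
    tfae_have 4 → 3 := fun h => by
      obtain ⟨hr1, hd⟩ := hB.of_hasMaxSolvIndex hpar hEnil h hr
      obtain ⟨B', C, L, b, -, -, -, hb, hJ, -⟩ := core hr1 hd
      have hfin := h.finrank_le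
      rw [Module.finrank_eq_card_basis b, Fintype.card_fin] at hfin
      exact ⟨hr1, isomorphic_of_two hd (hpar _) (hEnil _),
        hb.hasMaxNilIndex_quot (hb.isRegular_of_finrank_le hfin) _ hJ⟩
    tfae_have 3 → 1 := fun ⟨hr1, ⟨f, hf⟩, h⟩ => by
      have hd : d ⟨0, hr⟩ = 2 := by
        let g : Ek (k ⟨0, hr⟩) (lam ⟨0, hr⟩) →ₗ[K] Ek 2 ![(1 : K), -1] :=
          { toFun := f, map_add' := map_add f, map_smul' := map_smul f }
        have e := LinearEquiv.finrank_eq (LinearEquiv.ofBijective g hf)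
        rwa [finrank_evAlg, finrank_evAlg] at e
      obtain ⟨B', C, L, b, -, -, -, hb, hJ, -⟩ := core hr1 hd
      exact hb.isDistributive h2 (hb.isRegular_of_hasMaxNilIndex_quot _ hJ h)
    tfae_finish
  · intro hdist
    obtain ⟨hr1, hd⟩ := dims hdist.isModular
    obtain ⟨B', C, L, b, hB', hM, hL, hb, -, hsub⟩ := core hr1 hd
    have hreg := hb.isRegular_of_isModular h2 hquad hdist.isModular
    refine ⟨p, B', C, L, hB', hM, hL, hsub hreg, ?_⟩
    rw [rank_structureMatrix hB']
    have h1 := (hb.hasMaxSolvIndex hreg hE hsolv).finrank_le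
    have h3 := finrank_prod_top_top_lt hsolv hpos
    omega
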